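/- Let $R$ be a commutative ring and let $B$ be an associative unital $R$-algebra; put $B^e=B\otimes_R B^{\mathrm{op}}$. Let $d$ be an integer and suppose that $B$ is $d$-Calabi–Yau over $R$, that is: $B$ is flat over $R$; $B$ has a finite resolution by finitely generated projective $B^e$-modules; and there is given an isomorphism $\eta\colon \operatorname{RHom}_{B^e}(B,B^e)\to\Sigma^{-d}B$ in the derived category $D(B^e)$. Let $C_\bullet(B)$, $C_n(B)=B\otimes_R B^{\otimes_R n}$ (zero for $n<0$), be the Hochschild chain complex of $B$ over $R$, with Hochschild differential $\mathsf b$ and Connes operator $\mathsf B$, and let $HH_i(B)=H_i(C_\bullet(B),\mathsf b)$. Let $CC^-_\bullet(B)=(C_\bullet(B)[[u]],\mathsf b+u\mathsf B)$ be the negative cyclic complex, where $u$ has homological degree $-2$, so that $CC^-_i(B)=\prod_{n\ge 0}C_{i+2n}(B)\,u^n$ for $i\in\mathbb Z$, and let $HC^-_i(B)$ be its $i$-th homology. Then: 1. $HC^-_i(B)=0$ for all $i>d$; 2. the morphism of complexes $CC^-_\bullet(B)\to C_\bullet(B)$, $\sum_{n\ge0} b_nu^n\mapsto b_0$, induces an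 isomorphism $HC^-_d(B)\to HH_d(B)$. -/

import Mathlib

open CategoryTheory Limits TensorProduct

universe w u v

noncomputable section

namespace CY

/-- The enveloping algebra `Bᵉ = B ⊗_R Bᵒᵖ`. -/
abbrev Env (R : Type u) (B : Type v) [CommRing R] [Ring B] [Algebra R B] : Type v :=
  B ⊗[R] Bᵐᵒᵖ

section
variable (R : Type u) (B : Type v) [CommRing R] [Ring B] [Algebra R B]

/-- `B` as a left `Bᵉ`-module, `(b ⊗ c) • x = bxc`. -/
def diag : ModuleCat.{v} (Env R B) :=
  letI : Module (Env R B) B := TensorProduct.Algebra.module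
  ModuleCat.of (Env R B) B

/-- The isomorphism `Bᵉ ≅ (Bᵉ)ᵒᵖ`, `b ⊗ c ↦ c ⊗ b`, by which right `Bᵉ`-modules are viewed as left
`Bᵉ`-modules. -/
def swap : Env R B →ₐ[R] (Env R B)ᵐᵒᵖ :=
  (((Algebra.TensorProduct.comm R B Bᵐᵒᵖ).trans
    (Algebra.TensorProduct.congr (AlgEquiv.refl (R := R) (A₁ := Bᵐᵒᵖ)) (AlgEquiv.opOp R B))).trans
    (Algebra.TensorProduct.opAlgEquiv R R B Bᵐᵒᵖ)).toAlgHom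

lemma swap_tmul (b : B) (c : Bᵐᵒᵖ) :
    swap R B (b ⊗ₜ c) = MulOpposite.op (c.unop ⊗ₜ[R] MulOpposite.op b) := by
  simp [swap]

variable {R B}

/-- `Hom_{Bᵉ}(M, Bᵉ)` for a left `Bᵉ`-module `M`. It is a right `Bᵉ`-module by the right multiplication
of `Bᵉ` on itself, viewed as a left `Bᵉ`-module. -/
def dual (M : ModuleCat.{v} (Env R B)) : ModuleCat.{v} (Env R B) :=
  (ModuleCat.restrictScalars (swap R B).toRingHom).obj
    (ModuleCat.of (Env R B)ᵐᵒᵖ (M →ₗ[Env R B] Env R B))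

/-- Precomposition with `f`. -/
def dualMap {M N : ModuleCat.{v} (Env R B)} (f : M ⟶ N) : dual N ⟶ dual M :=
  (ModuleCat.restrictScalars (swap R B).toRingHom).map
    (ModuleCat.ofHom (X := (N →ₗ[Env R B] Env R B)) (Y := (M →ₗ[Env R B] Env R B))
      { toFun := fun φ => φ.comp f.hom
        map_add' := fun _ _ => rfl
        map_smul' := fun _ _ => rfl })

lemma dual_smul (M : ModuleCat.{v} (Env R B)) (e : Env R B) (φ : dual M) (m : M) :
    (show M →ₗ[Env R B] Env R B from e • φ) m =
      (show M →ₗ[Env R B] Env R B from φ) m * (swap R B e).unop := rfl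

/-- The cochain complex `Hom_{Bᵉ}(P_•, Bᵉ)` of `Bᵉ`-modules. -/
def dualComplex (P : ChainComplex (ModuleCat.{v} (Env R B)) ℕ) :
    CochainComplex (ModuleCat.{v} (Env R B)) ℕ where
  X n := dual (P.X n)
  d i j := dualMap (P.d j i)
  shape i j h := by
    rw [P.shape j i h]
    exact ModuleCat.hom_ext (LinearMap.ext fun φ => LinearMap.comp_zero φ)
  d_comp_d' i j k _ _ := by
    refine ModuleCat.hom_ext (LinearMap.ext fun φ => ?_)
    change (show P.X i →ₗ[Env R B] Env R B from φ) ∘ₗ ((P.d k j) ≫ (P.d j i)).hom = 0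
    rw [P.d_comp_d]
    exact LinearMap.comp_zero _

/-- `RHom_{Bᵉ}(M, Bᵉ)` in `D(Bᵉ)`, computed by a projective resolution of `M`. -/
def RHomEnv [HasDerivedCategory.{w} (ModuleCat.{v} (Env R B))] (M : ModuleCat.{v} (Env R B)) :
    DerivedCategory (ModuleCat.{v} (Env R B)) :=
  DerivedCategory.Q.obj
    ((dualComplex (projectiveResolution M).complex).extend ComplexShape.embeddingUpNat)

/-- A module is perfect if it has a finite resolution by finitely generated projective modules. -/
def IsPerfect (S : Type v) [Ring S] (M : ModuleCat.{v} S) : Prop :=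
  ∃ P : ProjectiveResolution M, (∀ n, Module.Finite S (P.complex.X n)) ∧
    ∃ N : ℕ, ∀ n, N < n → IsZero (P.complex.X n)

variable (R B) in
/-- `B` is homologically smooth over `R`: it is `R`-flat and perfect as a `Bᵉ`-module. -/
structure HomologicallySmooth : Prop where
  flat : Module.Flat R B
  perfect : IsPerfect (Env R B) (diag R B)

variable (R B) in
/-- The structure of a `d`-Calabi-Yau `R`-algebra on `B`: `B` is homologically smooth over `R`, and
`η : RHom_{Bᵉ}(B, Bᵉ) → Σ^{-d} B` is an isomorphism in `D(Bᵉ)`. -/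
structure CalabiYau [HasDerivedCategory.{w} (ModuleCat.{v} (Env R B))] (d : ℤ) where
  /-- homological smoothness -/
  smooth : HomologicallySmooth R B
  /-- the isomorphism in the derived category -/
  η : RHomEnv (diag R B) ≅ ((DerivedCategory.singleFunctor _ 0).obj (diag R B))⟦-d⟧
end

section fn
variable {B : Type v}

/-- The rotation `(a₀, …, aₙ) ↦ (aₙ, a₀, …, aₙ₋₁)` of tuples. -/
def rot {n : ℕ} (a : Fin (n + 1) → B) : Fin (n + 1) → B :=
  fun k => if k.val = 0 then a (Fin.last n) else a ⟨k.val - 1, by omega⟩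

variable [Ring B]

/-- The tuple `(a₀, …, aᵢaᵢ₊₁, …, aₙ₊₁)`, for `i ≤ n`. -/
def face {n : ℕ} (i : ℕ) (a : Fin (n + 2) → B) : Fin (n + 1) → B :=
  fun k => if k.val < i then a k.castSucc
    else if k.val = i then a k.castSucc * a k.succ else a k.succ

lemma face_face {n : ℕ} (i j : ℕ) (h : i ≤ j) (a : Fin (n + 3) → B) :
    face i (face (j + 1) a) = face j (face i a) := by
  funext k
  simp only [face, Fin.val_castSucc, Fin.val_succ]
  split_ifs <;> first | omega | rfl | simp [Fin.castSucc_succ, mul_assoc]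

lemma face_rot {n : ℕ} (i : ℕ) (h : i < n) (a : Fin (n + 2) → B) :
    face (i + 1) (rot a) = rot (face i a) := by
  funext k
  simp only [face, rot, Fin.val_castSucc, Fin.val_succ, Fin.val_last]
  split_ifs <;> first | omega | contradiction | rfl | (congr 2 <;> (try ext) <;> simp <;> omega)

lemma face_rot_last {n : ℕ} (a : Fin (n + 2) → B) :
    face 0 (rot (rot a)) = rot (face n a) := by
  funext k
  simp only [face, rot, Fin.val_castSucc, Fin.val_succ, Fin.val_last]
  split_ifs <;> first | omega | contradiction | rfl | (congr 2 <;> (try ext) <;> simp <;> omega)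

/-- The tuple `(1, a₀, …, aₙ)`. -/
def ins {n : ℕ} (a : Fin (n + 1) → B) : Fin (n + 2) → B := Fin.cons 1 a

lemma face_zero_ins {n : ℕ} (a : Fin (n + 1) → B) : face 0 (ins a) = a := by
  funext k
  refine Fin.cases ?_ (fun k => ?_) k <;> simp [face, ins]

lemma face_succ_ins {n : ℕ} (i : ℕ) (a : Fin (n + 2) → B) :
    face (i + 1) (ins a) = ins (face i a) := by
  funext k
  refine Fin.cases ?_ (fun k => ?_) k
  · simp [face, ins]
  · simp [face, ins]

lemma signed_sum {R A : Type*} [CommRing R] [AddCommGroup A] [Module R A] (n : ℕ) (F : ℕ → ℕ → A)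
    (h : ∀ i j, i ≤ j → j ≤ n → F i (j + 1) = F j i) :
    ∑ i ∈ Finset.range (n + 1), ∑ j ∈ Finset.range (n + 2), (-1 : R) ^ (i + j) • F i j = 0 := by
  induction n with
  | zero => simp [Finset.sum_range_succ, h 0 0 le_rfl le_rfl]
  | succ n ih =>
    rw [Finset.sum_range_succ]
    simp_rw [Finset.sum_range_succ _ (n + 2)]
    rw [Finset.sum_add_distrib, ih (fun i j hij hj => h i j hij (by omega)), zero_add,
      Finset.sum_range_succ _ (n + 1), h (n + 1) (n + 1) le_rfl le_rfl]
    have : ∑ i ∈ Finset.range (n + 1), (-1 : R) ^ (i + (n + 2)) • F i (n + 2)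
        = - ∑ i ∈ Finset.range (n + 1), (-1 : R) ^ (n + 1 + i) • F (n + 1) i := by
      rw [← Finset.sum_neg_distrib]
      refine Finset.sum_congr rfl fun i hi => ?_
      rw [h i (n + 1) (by have := Finset.mem_range.1 hi; omega) le_rfl, ← neg_smul]
      congr 1
      ring
    rw [this, pow_add _ (n + 1) (n + 2), pow_add _ (n + 1) (n + 1), pow_succ _ (n + 1)]
    simp

lemma lin_sum_comp {R M N P ι : Type*} [CommRing R] [AddCommGroup M] [AddCommGroup N]
    [AddCommGroup P] [Module R M] [Module R N] [Module R P] (I : Finset ι) (f : ι → N →ₗ[R] P)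
    (g : M →ₗ[R] N) : (∑ i ∈ I, f i) ∘ₗ g = ∑ i ∈ I, f i ∘ₗ g := by
  ext; simp

lemma lin_comp_sum {R M N P ι : Type*} [CommRing R] [AddCommGroup M] [AddCommGroup N]
    [AddCommGroup P] [Module R M] [Module R N] [Module R P] (I : Finset ι) (f : ι → M →ₗ[R] N)
    (g : N →ₗ[R] P) : g ∘ₗ (∑ i ∈ I, f i) = ∑ i ∈ I, g ∘ₗ f i := by
  ext; simp

end fn
section lin
variable (R : Type u) (B : Type v) [CommRing R] [Ring B] [Algebra R B]

/-- The module `B^{⊗(n+1)} = B ⊗ B^{⊗n}` of Hochschild `n`-chains, tensor products over `R`. -/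
def TensorPow (n : ℕ) : Type (max u v) := ⨂[R] (_ : Fin (n + 1)), B

instance (n : ℕ) : AddCommGroup (TensorPow R B n) :=
  inferInstanceAs (AddCommGroup (⨂[R] (_ : Fin (n + 1)), B))

instance (n : ℕ) : Module R (TensorPow R B n) :=
  inferInstanceAs (Module R (⨂[R] (_ : Fin (n + 1)), B))

/-- The pure tensor `a₀ ⊗ … ⊗ aₙ`. -/
def tp (n : ℕ) : MultilinearMap R (fun _ : Fin (n + 1) => B) (TensorPow R B n) :=
  PiTensorProduct.tprod R

/-- The linear map defined by a multilinear map. -/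
def tlift {n : ℕ} {M : Type*} [AddCommGroup M] [Module R M]
    (f : MultilinearMap R (fun _ : Fin (n + 1) => B) M) : TensorPow R B n →ₗ[R] M :=
  PiTensorProduct.lift f

lemma tlift_tp {n : ℕ} {M : Type*} [AddCommGroup M] [Module R M]
    (f : MultilinearMap R (fun _ : Fin (n + 1) => B) M) (a : Fin (n + 1) → B) :
    tlift R B f (tp R B n a) = f a :=
  PiTensorProduct.lift.tprod a

lemma tensorPow_ext {n : ℕ} {M : Type*} [AddCommGroup M] [Module R M] {f g : TensorPow R B n →ₗ[R] M}
    (h : ∀ a, f (tp R B n a) = g (tp R B n a)) : f = g :=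
  PiTensorProduct.ext (MultilinearMap.ext h)

/-- The linear map `a₀ ⊗ … ⊗ aₙ ↦ F(a)₀ ⊗ … ⊗ F(a)ₘ`, for a map `F` of tuples such that a change
of one entry of `a` changes one entry of `F(a)`, linearly. -/
def multi {n m : ℕ} (F : (Fin (n + 1) → B) → (Fin (m + 1) → B))
    (h : ∀ a i, ∃ (q : Fin (m + 1)) (l : B →ₗ[R] B),
      ∀ x, F (Function.update a i x) = Function.update (F a) q (l x)) : TensorPow R B n →ₗ[R] TensorPow R B m :=
  tlift R B
    { toFun := fun a => tp R B m (F a)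
      map_update_add' := by
        intro inst a i x y
        rw [Subsingleton.elim inst (instDecidableEqFin _)]
        obtain ⟨q, l, hl⟩ := h a i
        simp [hl]
      map_update_smul' := by
        intro inst a i x y
        rw [Subsingleton.elim inst (instDecidableEqFin _)]
        obtain ⟨q, l, hl⟩ := h a i
        simp [hl] }

lemma multi_tp {n m : ℕ} (F : (Fin (n + 1) → B) → (Fin (m + 1) → B)) (h)
    (a : Fin (n + 1) → B) :
    multi R B F h (tp R B n a) = tp R B m (F a) :=
  tlift_tp ..

lemma rot_update {n : ℕ} (a : Fin (n + 1) → B) (p : Fin (n + 1)) :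
    ∃ (q : Fin (n + 1)) (l : B →ₗ[R] B),
      ∀ x, rot (Function.update a p x) = Function.update (rot a) q (l x) := by
  by_cases h : p = Fin.last n
  · refine ⟨0, LinearMap.id, fun x => ?_⟩
    funext k
    simp only [rot, Function.update_apply, h, Fin.ext_iff, Fin.val_last, Fin.val_zero]
    split_ifs <;> first | omega | rfl
  · refine ⟨⟨p.val + 1, ?_⟩, LinearMap.id, fun x => ?_⟩
    · have := p.2; simp only [Fin.ext_iff, Fin.val_last] at h; omega
    funext k
    simp only [Fin.ext_iff, Fin.val_last] at h
    simp only [rot, Function.update_apply, Fin.ext_iff, Fin.val_last]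
    split_ifs <;> first | omega | rfl

lemma face_update {n : ℕ} (i : ℕ) (hi : i ≤ n) (a : Fin (n + 2) → B) (p : Fin (n + 2)) :
    ∃ (q : Fin (n + 1)) (l : B →ₗ[R] B),
      ∀ x, face i (Function.update a p x) = Function.update (face i a) q (l x) := by
  have hp := p.2
  rcases lt_trichotomy p.val i with h | h | h
  · refine ⟨⟨p.val, by omega⟩, LinearMap.id, fun x => ?_⟩
    funext k
    simp only [face, Function.update_apply, Fin.ext_iff, Fin.val_castSucc, Fin.val_succ]
    split_ifs <;> first | omega | rfl
  · refine ⟨⟨p.val, by omega⟩, LinearMap.mulRight R (a ⟨i + 1, by omega⟩), fun x => ?_⟩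
    funext k
    simp only [face, Function.update_apply, Fin.ext_iff, Fin.val_castSucc, Fin.val_succ]
    split_ifs <;> first | omega | rfl | skip
    simp only [LinearMap.mulRight_apply]
    congr 2
    ext; simp; omega
  · by_cases h' : p.val = i + 1
    · refine ⟨⟨i, by omega⟩, LinearMap.mulLeft R (a ⟨i, by omega⟩), fun x => ?_⟩
      funext k
      simp only [face, Function.update_apply, Fin.ext_iff, Fin.val_castSucc, Fin.val_succ]
      split_ifs <;> first | omega | rfl | skip
      simp only [LinearMap.mulLeft_apply]
      congr 2
      ext; simp; omega
    · refine ⟨⟨p.val - 1, by omega⟩, LinearMap.id, fun x => ?_⟩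
      funext k
      simp only [face, Function.update_apply, Fin.ext_iff, Fin.val_castSucc, Fin.val_succ]
      split_ifs <;> first | omega | rfl

lemma ins_update {n : ℕ} (a : Fin (n + 1) → B) (p : Fin (n + 1)) :
    ∃ (q : Fin (n + 2)) (l : B →ₗ[R] B),
      ∀ x, ins (Function.update a p x) = Function.update (ins a) q (l x) := by
  refine ⟨p.succ, LinearMap.id, fun x => ?_⟩
  exact Fin.cons_update (α := fun _ => B) 1 a p x

/-- The map `a₀ ⊗ … ⊗ aₙ ↦ aₙ ⊗ a₀ ⊗ … ⊗ aₙ₋₁`. -/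
def cyclicPerm (n : ℕ) : Module.End R (TensorPow R B n) := multi R B rot (rot_update R B)

/-- The face maps `dᵢ`: for `i ≤ n`, `dᵢ(a₀ ⊗ … ⊗ aₙ₊₁) = a₀ ⊗ … ⊗ aᵢaᵢ₊₁ ⊗ … ⊗ aₙ₊₁`, and
`dₙ₊₁(a₀ ⊗ … ⊗ aₙ₊₁) = aₙ₊₁a₀ ⊗ a₁ ⊗ … ⊗ aₙ`. -/
def faceMap (n i : ℕ) : TensorPow R B (n + 1) →ₗ[R] TensorPow R B n :=
  if h : i ≤ n then multi R B (face i) (face_update R B i h)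
  else multi R B (face 0) (face_update R B 0 (Nat.zero_le n)) ∘ₗ cyclicPerm R B (n + 1)

/-- The map `a₀ ⊗ … ⊗ aₙ ↦ 1 ⊗ a₀ ⊗ … ⊗ aₙ`. -/
def unitIns (n : ℕ) : TensorPow R B n →ₗ[R] TensorPow R B (n + 1) := multi R B ins (ins_update R B)

lemma cyclicPerm_tp (n : ℕ) (a : Fin (n + 1) → B) :
    cyclicPerm R B n (tp R B n a) = tp R B _ (rot a) := multi_tp ..

lemma faceMap_tp {n i : ℕ} (h : i ≤ n) (a : Fin (n + 2) → B) :
    faceMap R B n i (tp R B _ a) = tp R B _ (face i a) := by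
  rw [faceMap, dif_pos h, multi_tp]

lemma unitIns_tp (n : ℕ) (a : Fin (n + 1) → B) :
    unitIns R B n (tp R B _ a) = tp R B _ (ins a) := multi_tp ..

lemma faceMap_last (n : ℕ) : faceMap R B n (n + 1) = faceMap R B n 0 ∘ₗ cyclicPerm R B (n + 1) := by
  rw [faceMap, dif_neg (by omega), faceMap, dif_pos (Nat.zero_le n)]

lemma faceMap_succ_cyclicPerm (n i : ℕ) (h : i ≤ n) :
    faceMap R B n (i + 1) ∘ₗ cyclicPerm R B (n + 1) = cyclicPerm R B n ∘ₗ faceMap R B n i := by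
  rcases h.lt_or_eq with h' | rfl
  · refine tensorPow_ext R B fun a => ?_
    simp [cyclicPerm_tp, faceMap_tp R B h, faceMap_tp R B (show i + 1 ≤ n from h'), face_rot i h']
  · rw [faceMap_last]
    refine tensorPow_ext R B fun a => ?_
    simp [cyclicPerm_tp, faceMap_tp, face_rot_last]

lemma faceMap_faceMap (n i j : ℕ) (hij : i ≤ j) (hj : j ≤ n + 1) :
    faceMap R B n i ∘ₗ faceMap R B (n + 1) (j + 1) = faceMap R B n j ∘ₗ faceMap R B (n + 1) i := by
  have key : ∀ i j, i ≤ j → j ≤ n →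
      faceMap R B n i ∘ₗ faceMap R B (n + 1) (j + 1) = faceMap R B n j ∘ₗ faceMap R B (n + 1) i := by
    intro i j hij hj
    refine tensorPow_ext R B fun a => ?_
    simp [faceMap_tp R B (show i ≤ n by omega), faceMap_tp R B (show j + 1 ≤ n + 1 by omega),
      faceMap_tp R B (show i ≤ n + 1 by omega), faceMap_tp R B hj, face_face i j hij]
  rcases hj.lt_or_eq with hj' | rfl
  · exact key i j hij (by omega)
  rw [faceMap_last R B (n + 1), faceMap_last R B n, LinearMap.comp_assoc]
  rcases Nat.eq_zero_or_pos i with rfl | hi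
  · rw [← faceMap_succ_cyclicPerm R B (n + 1) 0 (by omega), ← LinearMap.comp_assoc, ← LinearMap.comp_assoc,
      key 0 0 le_rfl (by omega)]
  · rcases hij.lt_or_eq with h | rfl
    · rw [← faceMap_succ_cyclicPerm R B (n + 1) i (by omega), ← LinearMap.comp_assoc, ← LinearMap.comp_assoc,
        key 0 i (by omega) (by omega)]
    · rw [faceMap_last, ← faceMap_succ_cyclicPerm R B (n + 1) (n + 1) le_rfl, faceMap_last]
      rw [LinearMap.comp_assoc, ← LinearMap.comp_assoc _ (faceMap R B (n + 1) 0),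
        ← faceMap_succ_cyclicPerm R B (n + 1) 0 (by omega)]
      simp only [← LinearMap.comp_assoc]
      rw [key 0 0 le_rfl (by omega)]

lemma faceMap_zero_unitIns (n : ℕ) : faceMap R B n 0 ∘ₗ unitIns R B n = LinearMap.id := by
  refine tensorPow_ext R B fun a => ?_
  simp [unitIns_tp, faceMap_tp, face_zero_ins]

lemma faceMap_succ_unitIns (n i : ℕ) (h : i ≤ n) :
    faceMap R B (n + 1) (i + 1) ∘ₗ unitIns R B (n + 1) = unitIns R B n ∘ₗ faceMap R B n i := by
  refine tensorPow_ext R B fun a => ?_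
  simp [unitIns_tp, faceMap_tp R B h, faceMap_tp R B (show i + 1 ≤ n + 1 by omega), face_succ_ins]

lemma rot_iter {B : Type v} {n : ℕ} (a : Fin (n + 1) → B) (j : ℕ) (hj : j ≤ n + 1)
    (k : Fin (n + 1)) :
    rot^[j] a k = if h : j ≤ k.val then a ⟨k.val - j, by omega⟩
      else a ⟨k.val + (n + 1) - j, by omega⟩ := by
  induction j generalizing k with
  | zero => simp
  | succ j ih =>
    have hk := k.2
    rw [Function.iterate_succ_apply', rot]
    simp only [ih (by omega), Fin.val_last]
    split_ifs <;> first | omega | (congr 2; omega)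

lemma cyclicPerm_pow (n : ℕ) : cyclicPerm R B n ^ (n + 1) = 1 := by
  have h : ∀ (j : ℕ) (a : Fin (n + 1) → B), (cyclicPerm R B n ^ j) (tp R B _ a) =
      tp R B _ (rot^[j] a) := by
    intro j
    induction j with
    | zero => intro a; simp
    | succ j ih => intro a; rw [pow_succ, Module.End.mul_apply, cyclicPerm_tp, ih]; rfl
  refine tensorPow_ext R B fun a => ?_
  rw [h]
  rw [Module.End.one_apply]
  congr 1
  funext k
  rw [rot_iter a (n + 1) le_rfl, dif_neg (by omega)]
  congr 1
  ext
  simp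

/-- The signed cyclic operator `t(a₀ ⊗ … ⊗ aₙ) = (-1)ⁿ aₙ ⊗ a₀ ⊗ … ⊗ aₙ₋₁`. -/
def cyclicOp (n : ℕ) : Module.End R (TensorPow R B n) := (-1 : R) ^ n • cyclicPerm R B n

/-- The norm operator `N = 1 + t + ⋯ + tⁿ` on `n`-chains. -/
def normOp (n : ℕ) : Module.End R (TensorPow R B n) := ∑ i ∈ Finset.range (n + 1), cyclicOp R B n ^ i

/-- The Hochschild differential on `(n+1)`-chains: `b(a₀ ⊗ … ⊗ aₙ₊₁)` is the sum of
`(-1)ⁱ a₀ ⊗ … ⊗ aᵢaᵢ₊₁ ⊗ … ⊗ aₙ₊₁` for `0 ≤ i ≤ n` and of `(-1)ⁿ⁺¹ aₙ₊₁a₀ ⊗ a₁ ⊗ … ⊗ aₙ`. -/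
def hochDiff (n : ℕ) : TensorPow R B (n + 1) →ₗ[R] TensorPow R B n :=
  ∑ i ∈ Finset.range (n + 2), (-1 : R) ^ i • faceMap R B n i

/-- The part `∑_{i ≤ n} (-1)ⁱ dᵢ` of the Hochschild differential (used in proofs only). -/
def barDiff (n : ℕ) : TensorPow R B (n + 1) →ₗ[R] TensorPow R B n :=
  ∑ i ∈ Finset.range (n + 1), (-1 : R) ^ i • faceMap R B n i

/-- The Connes operator `(1 - t) s N` on `n`-chains, where `s` inserts a unit in front. Explicitly
`a₀ ⊗ … ⊗ aₙ` goes to the sum over `0 ≤ i ≤ n` of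
`(-1)^{ni} 1 ⊗ aᵢ ⊗ … ⊗ aₙ ⊗ a₀ ⊗ … ⊗ aᵢ₋₁` and
`(-1)^{n(i+1)} aᵢ₋₁ ⊗ 1 ⊗ aᵢ ⊗ … ⊗ aₙ ⊗ a₀ ⊗ … ⊗ aᵢ₋₂` (indices modulo `n + 1`). -/
def connesOp (n : ℕ) : TensorPow R B n →ₗ[R] TensorPow R B (n + 1) := (1 - cyclicOp R B (n + 1)) ∘ₗ unitIns R B n ∘ₗ normOp R B n

lemma hochDiff_hochDiff (n : ℕ) : hochDiff R B n ∘ₗ hochDiff R B (n + 1) = 0 := by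
  have := signed_sum (R := R) (n + 1) (fun i j => faceMap R B n i ∘ₗ faceMap R B (n + 1) j)
    (fun i j hij hj => faceMap_faceMap R B n i j hij hj)
  rw [← this, hochDiff, hochDiff]
  simp only [lin_sum_comp, lin_comp_sum, LinearMap.comp_smul, LinearMap.smul_comp]
  rw [Finset.sum_comm]
  refine Finset.sum_congr rfl fun i _ => ?_
  rw [Finset.smul_sum]
  refine Finset.sum_congr rfl fun j _ => ?_
  rw [smul_smul, pow_add, mul_comm]

lemma cyclicOp_pow (n : ℕ) : cyclicOp R B n ^ (n + 1) = 1 := by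
  rw [cyclicOp, smul_pow, cyclicPerm_pow, ← pow_mul, (Nat.even_mul_succ_self n).neg_one_pow, one_smul]

lemma cyclicOp_mul_normOp (n : ℕ) : cyclicOp R B n * normOp R B n = normOp R B n := by
  rw [normOp, Finset.mul_sum]
  simp only [← pow_succ']
  rw [Finset.sum_range_succ, cyclicOp_pow, Finset.sum_range_succ' _ n, pow_zero]

lemma normOp_mul_cyclicOp (n : ℕ) : normOp R B n * cyclicOp R B n = normOp R B n := by
  rw [normOp, Finset.sum_mul]
  simp only [← pow_succ]
  rw [Finset.sum_range_succ, cyclicOp_pow, Finset.sum_range_succ' _ n, pow_zero]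

lemma faceMap_succ_cyclicOp (n i : ℕ) (h : i ≤ n) :
    faceMap R B n (i + 1) ∘ₗ cyclicOp R B (n + 1) = - (cyclicOp R B n ∘ₗ faceMap R B n i) := by
  rw [cyclicOp, cyclicOp, LinearMap.comp_smul, LinearMap.smul_comp, faceMap_succ_cyclicPerm R B n i h, pow_succ, mul_neg_one]
  exact neg_smul _ _

lemma faceMap_zero_cyclicOp (n : ℕ) :
    faceMap R B n 0 ∘ₗ cyclicOp R B (n + 1) = (-1 : R) ^ (n + 1) • faceMap R B n (n + 1) := by
  rw [cyclicOp, LinearMap.comp_smul, faceMap_last]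

lemma hochDiff_cyclicOp (n : ℕ) : hochDiff R B n ∘ₗ (1 - cyclicOp R B (n + 1)) = (1 - cyclicOp R B n) ∘ₗ barDiff R B n := by
  have h1 : hochDiff R B n ∘ₗ cyclicOp R B (n + 1) =
      (-1 : R) ^ (n + 1) • faceMap R B n (n + 1) + cyclicOp R B n ∘ₗ barDiff R B n := by
    rw [hochDiff, barDiff, Finset.sum_range_succ' _ (n + 1), LinearMap.add_comp, LinearMap.smul_comp, faceMap_zero_cyclicOp, pow_zero,
      one_smul, add_comm ((-1 : R) ^ (n + 1) • _)]
    congr 1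
    rw [lin_sum_comp, lin_comp_sum]
    refine Finset.sum_congr rfl fun i hi => ?_
    rw [LinearMap.smul_comp, faceMap_succ_cyclicOp R B n i (by have := Finset.mem_range.1 hi; omega),
      LinearMap.comp_smul, pow_succ]
    simp
  have h2 : hochDiff R B n = barDiff R B n + (-1 : R) ^ (n + 1) • faceMap R B n (n + 1) := by
    rw [hochDiff, Finset.sum_range_succ, barDiff]
  rw [LinearMap.comp_sub, LinearMap.sub_comp, h1]
  change hochDiff R B n - _ = barDiff R B n - _
  rw [h2]
  abel

lemma barDiff_unitIns_zero : barDiff R B 0 ∘ₗ unitIns R B 0 = LinearMap.id := by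
  simp [barDiff, faceMap_zero_unitIns]

lemma barDiff_unitIns_succ (n : ℕ) :
    barDiff R B (n + 1) ∘ₗ unitIns R B (n + 1) + unitIns R B n ∘ₗ barDiff R B n = LinearMap.id := by
  have h : ∑ i ∈ Finset.range (n + 1),
      ((-1 : R) ^ (i + 1) • faceMap R B (n + 1) (i + 1)) ∘ₗ unitIns R B (n + 1) =
      - ∑ i ∈ Finset.range (n + 1), unitIns R B n ∘ₗ ((-1 : R) ^ i • faceMap R B n i) := by
    rw [← Finset.sum_neg_distrib]
    refine Finset.sum_congr rfl fun i hi => ?_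
    rw [LinearMap.smul_comp, faceMap_succ_unitIns R B n i (by have := Finset.mem_range.1 hi; omega),
      LinearMap.comp_smul, pow_succ, mul_neg_one]
    exact neg_smul _ _
  have h1 : barDiff R B (n + 1) = (∑ i ∈ Finset.range (n + 1),
      (-1 : R) ^ (i + 1) • faceMap R B (n + 1) (i + 1)) + faceMap R B (n + 1) 0 := by
    rw [barDiff, Finset.sum_range_succ' _ (n + 1), pow_zero, one_smul]
  rw [h1, LinearMap.add_comp, faceMap_zero_unitIns, barDiff, lin_sum_comp, lin_comp_sum, h]
  abel

lemma barDiff_normOp (n : ℕ) : barDiff R B n ∘ₗ normOp R B (n + 1) = normOp R B n ∘ₗ faceMap R B n 0 ∘ₗ normOp R B (n + 1) := by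
  have key : ∀ i, i ≤ n + 1 → (-1 : R) ^ i • (faceMap R B n i ∘ₗ normOp R B (n + 1)) =
      (cyclicOp R B n ^ i) ∘ₗ faceMap R B n 0 ∘ₗ normOp R B (n + 1) := by
    intro i
    induction i with
    | zero => intro _; rw [pow_zero, pow_zero, one_smul]; rfl
    | succ i ih =>
      intro hi
      rw [pow_succ' (cyclicOp R B n) i, Module.End.mul_eq_comp, LinearMap.comp_assoc, ← ih (by omega),
        ← cyclicOp_mul_normOp, Module.End.mul_eq_comp, ← LinearMap.comp_assoc,
        faceMap_succ_cyclicOp R B n i (by omega), ← Module.End.mul_eq_comp (cyclicOp R B (n + 1)), cyclicOp_mul_normOp,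
        LinearMap.comp_smul, pow_succ, LinearMap.neg_comp, LinearMap.comp_assoc]
      simp
  rw [barDiff, lin_sum_comp]
  conv_rhs => rw [normOp, lin_sum_comp]
  refine Finset.sum_congr rfl fun i hi => ?_
  rw [LinearMap.smul_comp, key i (by have := Finset.mem_range.1 hi; omega)]

lemma normOp_hochDiff (n : ℕ) : normOp R B n ∘ₗ hochDiff R B n = normOp R B n ∘ₗ faceMap R B n 0 ∘ₗ normOp R B (n + 1) := by
  have key : ∀ m, m ≤ n + 1 → normOp R B n ∘ₗ faceMap R B n 0 ∘ₗ (cyclicOp R B (n + 1) ^ (m + 1)) =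
      (-1 : R) ^ (n + 1 - m) • (normOp R B n ∘ₗ faceMap R B n (n + 1 - m)) := by
    intro m
    induction m with
    | zero =>
      intro _
      rw [zero_add, pow_one, faceMap_zero_cyclicOp, LinearMap.comp_smul, Nat.sub_zero]
    | succ m ih =>
      intro hm
      obtain ⟨k, rfl⟩ : ∃ k, n = k + m := ⟨n - m, by omega⟩
      have e1 : k + m + 1 - m = k + 1 := by omega
      have e2 : k + m + 1 - (m + 1) = k := by omega
      have := ih (by omega)
      rw [e1] at this
      rw [e2, pow_succ, Module.End.mul_eq_comp, ← LinearMap.comp_assoc, ← LinearMap.comp_assoc,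
        LinearMap.comp_assoc _ _ (normOp R B (k + m)), this, LinearMap.smul_comp, LinearMap.comp_assoc,
        faceMap_succ_cyclicOp R B _ k (by omega), LinearMap.comp_neg, ← LinearMap.comp_assoc,
        ← Module.End.mul_eq_comp, normOp_mul_cyclicOp, pow_succ]
      simp
  have e : normOp R B (n + 1) = ∑ m ∈ Finset.range (n + 2), cyclicOp R B (n + 1) ^ (m + 1) := by
    conv_lhs => rw [← normOp_mul_cyclicOp, normOp, Finset.sum_mul]
    simp only [← pow_succ]
  rw [hochDiff, e, lin_comp_sum, lin_comp_sum, lin_comp_sum,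
    ← Finset.sum_range_reflect]
  refine Finset.sum_congr rfl fun m hm => ?_
  rw [key m (by have := Finset.mem_range.1 hm; omega), LinearMap.comp_smul]
  rfl

lemma connesOp_connesOp (n : ℕ) : connesOp R B (n + 1) ∘ₗ connesOp R B n = 0 := by
  have : normOp R B (n + 1) ∘ₗ (1 - cyclicOp R B (n + 1)) = 0 := by
    rw [← Module.End.mul_eq_comp, mul_sub, mul_one, normOp_mul_cyclicOp, sub_self]
  rw [connesOp, connesOp, LinearMap.comp_assoc, LinearMap.comp_assoc, ← LinearMap.comp_assoc _ _ (normOp R B _),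
    this]
  simp

lemma hochDiff_connesOp_zero : hochDiff R B 0 ∘ₗ connesOp R B 0 = 0 := by
  rw [connesOp, ← LinearMap.comp_assoc, hochDiff_cyclicOp, LinearMap.comp_assoc, ← LinearMap.comp_assoc _ _ (barDiff R B 0),
    barDiff_unitIns_zero, LinearMap.id_comp, ← Module.End.mul_eq_comp, sub_mul, one_mul, cyclicOp_mul_normOp, sub_self]

lemma hochDiff_connesOp_succ (n : ℕ) :
    hochDiff R B (n + 1) ∘ₗ connesOp R B (n + 1) + connesOp R B n ∘ₗ hochDiff R B n = 0 := by
  rw [connesOp, connesOp, ← LinearMap.comp_assoc, hochDiff_cyclicOp, LinearMap.comp_assoc, LinearMap.comp_assoc,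
    LinearMap.comp_assoc, normOp_hochDiff, ← barDiff_normOp,
    ← LinearMap.comp_add, ← LinearMap.comp_assoc, ← LinearMap.comp_assoc (normOp R B (n + 1)),
    ← LinearMap.add_comp,
    barDiff_unitIns_succ, LinearMap.id_comp, ← Module.End.mul_eq_comp, sub_mul, one_mul, cyclicOp_mul_normOp, sub_self]


/-- The Hochschild chains in homological degree `i ∈ ℤ`; they vanish for `i < 0`. -/
def hochX : ℤ → ModuleCat.{max u v} R
  | .ofNat n => ModuleCat.of R (TensorPow R B n)
  | .negSucc _ => ModuleCat.of R PUnit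

/-- The Hochschild differential between the chains in degrees `i` and `j`, zero unless `i = j + 1`. -/
def hochD : ∀ i j : ℤ, hochX R B i ⟶ hochX R B j
  | .ofNat i, .ofNat j => if h : j + 1 = i then
      eqToHom (by rw [← h]; rfl) ≫ ModuleCat.ofHom (hochDiff R B j) else 0
  | _, _ => 0

/-- The Connes operator between the chains in degrees `i` and `j`, zero unless `j = i + 1`. -/
def connesD : ∀ i j : ℤ, hochX R B i ⟶ hochX R B j
  | .ofNat i, .ofNat j => if h : i + 1 = j then
      ModuleCat.ofHom (connesOp R B i) ≫ eqToHom (by rw [← h]; rfl) else 0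
  | _, _ => 0

lemma hochD_succ (n : ℕ) : hochD R B (.ofNat (n + 1)) (.ofNat n) = ModuleCat.ofHom (hochDiff R B n) := by
  rw [hochD, dif_pos rfl]; rfl

lemma connesD_succ (n : ℕ) : connesD R B (.ofNat n) (.ofNat (n + 1)) = ModuleCat.ofHom (connesOp R B n) := by
  rw [connesD, dif_pos rfl]; rfl

lemma hochD_shape (i j : ℤ) (h : j + 1 ≠ i) : hochD R B i j = 0 := by
  rcases i with i | i <;> rcases j with j | j <;> try rfl
  rw [hochD, dif_neg]
  rintro rfl
  exact h rfl

lemma connesD_shape (i j : ℤ) (h : i + 1 ≠ j) : connesD R B i j = 0 := by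
  rcases i with i | i <;> rcases j with j | j <;> try rfl
  rw [connesD, dif_neg]
  rintro rfl
  exact h rfl

lemma hochD_hochD (i j k : ℤ) : hochD R B i j ≫ hochD R B j k = 0 := by
  by_cases h : j + 1 = i
  swap
  · rw [hochD_shape R B i j h, zero_comp]
  by_cases h' : k + 1 = j
  swap
  · rw [hochD_shape R B j k h', comp_zero]
  subst h h'
  rcases k with n | n
  · change hochD R B (.ofNat (n + 1 + 1)) (.ofNat (n + 1)) ≫ hochD R B (.ofNat (n + 1)) (.ofNat n) = 0
    rw [hochD_succ, hochD_succ]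
    exact congrArg ModuleCat.ofHom (hochDiff_hochDiff R B n)
  · have : hochD R B (.negSucc n + 1) (.negSucc n) = 0 := by
      generalize (Int.negSucc n + 1) = m
      rcases m with m | m <;> rfl
    rw [this, comp_zero]

lemma connesD_connesD (i j k : ℤ) : connesD R B i j ≫ connesD R B j k = 0 := by
  by_cases h : i + 1 = j
  swap
  · rw [connesD_shape R B i j h, zero_comp]
  by_cases h' : j + 1 = k
  swap
  · rw [connesD_shape R B j k h', comp_zero]
  subst h h'
  rcases i with n | n
  · change connesD R B (.ofNat n) (.ofNat (n + 1)) ≫ connesD R B (.ofNat (n + 1)) (.ofNat (n + 1 + 1)) = 0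
    rw [connesD_succ, connesD_succ]
    exact congrArg ModuleCat.ofHom (connesOp_connesOp R B n)
  · have : connesD R B (.negSucc n) (.negSucc n + 1) = 0 := by
      generalize (Int.negSucc n + 1) = m
      rcases m with m | m <;> rfl
    rw [this, zero_comp]

lemma hochD_connesD (i : ℤ) :
    hochD R B i (i - 1) ≫ connesD R B (i - 1) i + connesD R B i (i + 1) ≫ hochD R B (i + 1) i = 0 := by
  rcases i with (_ | n) | n
  · have h1 : hochD R B (.ofNat 0) (.ofNat 0 - 1) = 0 := rfl
    rw [h1, zero_comp, zero_add]
    change connesD R B (.ofNat 0) (.ofNat (0 + 1)) ≫ hochD R B (.ofNat (0 + 1)) (.ofNat 0) = 0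
    rw [connesD_succ, hochD_succ]
    exact congrArg ModuleCat.ofHom (hochDiff_connesOp_zero R B)
  · have e : (Int.ofNat (n + 1)) - 1 = .ofNat n := by simp
    rw [e]
    change hochD R B (.ofNat (n + 1)) (.ofNat n) ≫ connesD R B (.ofNat n) (.ofNat (n + 1)) +
      connesD R B (.ofNat (n + 1)) (.ofNat (n + 1 + 1)) ≫ hochD R B (.ofNat (n + 1 + 1)) (.ofNat (n + 1))
      = 0
    rw [connesD_succ, hochD_succ, hochD_succ, connesD_succ]
    refine (add_comm _ _).trans ?_
    exact congrArg ModuleCat.ofHom (hochDiff_connesOp_succ R B n)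
  · have h1 : connesD R B (.negSucc n) (.negSucc n + 1) = 0 := by
      generalize (Int.negSucc n + 1) = m
      rcases m with m | m <;> rfl
    have h2 : hochD R B (.negSucc n) (.negSucc n - 1) = 0 := by
      generalize (Int.negSucc n - 1) = m
      rcases m with m | m <;> rfl
    rw [h1, h2, zero_comp, zero_comp, add_zero]
end lin

/-- A mixed complex: a chain complex `(K, b)` with an operator `B` of homological degree `1`
such that `B² = 0` and `bB + Bb = 0`. -/
structure MixedComplex (R : Type u) [CommRing R] where
  K : HomologicalComplex (ModuleCat.{w} R) (ComplexShape.down ℤ)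
  B : ∀ i j : ℤ, K.X i ⟶ K.X j
  shape : ∀ i j, i + 1 ≠ j → B i j = 0
  B_comp_B : ∀ i j k, B i j ≫ B j k = 0
  anticomm : ∀ i, K.d i (i - 1) ≫ B (i - 1) i + B i (i + 1) ≫ K.d (i + 1) i = 0

/-- The Hochschild chain complex `(C_•(B), b)` of the `R`-algebra `B`, with its Connes operator. -/
def hochschildMixed (R : Type u) (B : Type v) [CommRing R] [Ring B] [Algebra R B] :
    MixedComplex.{max u v} R where
  K :=
    { X := hochX R B
      d := hochD R B
      shape := hochD_shape R B
      d_comp_d' := fun i j k _ _ => hochD_hochD R B i j k }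
  B := connesD R B
  shape := connesD_shape R B
  B_comp_B := connesD_connesD R B
  anticomm := hochD_connesD R B

namespace MixedComplex
variable {R : Type u} [CommRing R] (M : MixedComplex.{w} R)

lemma anticomm_apply {i j k l : ℤ} (hij : i + 1 = j) (hk : k + 1 = i) (hl : l = i) (x : M.K.X i) :
    (M.B k l).hom ((M.K.d i k).hom x) + (M.K.d j l).hom ((M.B i j).hom x) = 0 := by
  subst hij hl
  obtain rfl : k = l - 1 := by omega
  have := congrArg (fun f => f.hom x) (M.anticomm l)
  simpa using this

/-- The differential `b + uB` on `K[[u]]`, where `u` has homological degree `-2`. A homogeneous element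
`∑ xₙ uⁿ` of degree `i` has `xₙ` in degree `i + 2n`. The coefficient of `uⁿ` in `(b + uB) x` is
`b xₙ + B xₙ₋₁` (and `b x₀` for `n = 0`). -/
def negD (i j : ℤ) : (∀ n : ℕ, M.K.X (i + 2 * n)) →ₗ[R] (∀ n : ℕ, M.K.X (j + 2 * n)) :=
  LinearMap.pi fun n => (M.K.d (i + 2 * n) (j + 2 * n)).hom ∘ₗ LinearMap.proj n +
    match n with
    | 0 => 0
    | m + 1 => (M.B (i + 2 * m) (j + 2 * (m + 1 : ℕ))).hom ∘ₗ LinearMap.proj m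

lemma negD_zero (i j : ℤ) (x : ∀ n : ℕ, M.K.X (i + 2 * n)) :
    M.negD i j x 0 = (M.K.d (i + 2 * (0 : ℕ)) (j + 2 * (0 : ℕ))).hom (x 0) := by
  simp [negD]

lemma negD_succ (i j : ℤ) (x : ∀ n : ℕ, M.K.X (i + 2 * n)) (m : ℕ) :
    M.negD i j x (m + 1) = (M.K.d (i + 2 * (m + 1 : ℕ)) (j + 2 * (m + 1 : ℕ))).hom (x (m + 1)) +
      (M.B (i + 2 * m) (j + 2 * (m + 1 : ℕ))).hom (x m) := by
  simp [negD]

/-- The negative cyclic complex `(K[[u]], b + uB)`; in degree `i` it is `∏ₙ K_{i+2n} uⁿ`. -/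
def negCyclic : HomologicalComplex (ModuleCat.{w} R) (ComplexShape.down ℤ) where
  X i := ModuleCat.of R (∀ n : ℕ, M.K.X (i + 2 * n))
  d i j := ModuleCat.ofHom (M.negD i j)
  shape i j h := by
    refine ModuleCat.hom_ext (LinearMap.ext fun x => ?_)
    have h' : j + 1 ≠ i := h
    change M.negD i j x = 0
    funext n
    rcases n with _ | m
    · rw [negD_zero, M.K.shape _ _ (fun e => h' (by simpa using e))]
      rfl
    · rw [negD_succ, M.K.shape _ _ (fun e => h' (by simpa [add_right_comm] using e)), M.shape]
      · simp
      · push_cast; omega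
  d_comp_d' i j k hij hjk := by
    have hij' : j + 1 = i := hij
    have hjk' : k + 1 = j := hjk
    have dd : ∀ (p q r : ℤ) (x : M.K.X p), (M.K.d q r).hom ((M.K.d p q).hom x) = 0 := by
      intro p q r x
      rw [← ModuleCat.comp_apply, M.K.d_comp_d]; rfl
    have BB : ∀ (p q r : ℤ) (x : M.K.X p), (M.B q r).hom ((M.B p q).hom x) = 0 := by
      intro p q r x
      rw [← ModuleCat.comp_apply, M.B_comp_B]; rfl
    refine ModuleCat.hom_ext (LinearMap.ext fun x => ?_)
    change M.negD j k (M.negD i j x) = 0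
    funext n
    rcases n with _ | _ | m
    · rw [negD_zero, negD_zero, dd]; rfl
    · rw [negD_succ, negD_succ, negD_zero, map_add, dd, zero_add]
      refine (add_comm _ _).trans ((congrArg₂ (· + ·) rfl (zero_add _)).trans ?_)
      exact M.anticomm_apply (i := i + 2 * ((0 : ℕ) : ℤ)) (j := j + 2 * ((0 + 1 : ℕ) : ℤ))
        (k := j + 2 * ((0 : ℕ) : ℤ)) (l := k + 2 * ((0 + 1 : ℕ) : ℤ))
        (by push_cast; omega) (by push_cast; omega) (by push_cast; omega) _
    · rw [negD_succ, negD_succ, negD_succ, map_add, map_add, dd, BB, zero_add, add_zero]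
      refine (add_comm _ _).trans ?_
      exact M.anticomm_apply (i := i + 2 * ((m + 1 : ℕ) : ℤ))
        (j := j + 2 * ((m + 1 + 1 : ℕ) : ℤ)) (k := j + 2 * ((m + 1 : ℕ) : ℤ)) (l := k + 2 * ((m + 1 + 1 : ℕ) : ℤ))
        (by push_cast; omega) (by push_cast; omega) (by push_cast; omega) _

/-- The projection `K[[u]] → K`, `∑ xₙ uⁿ ↦ x₀`. (The isomorphism `XIsoOfEq` is the identification
of `K_{i+2·0}` with `K_i`.) -/
def negProj : M.negCyclic ⟶ M.K where
  f i := ModuleCat.ofHom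
    ((M.K.XIsoOfEq (show i + 2 * ((0 : ℕ) : ℤ) = i by simp)).hom.hom ∘ₗ LinearMap.proj 0)
  comm' i j _ := by
    refine ModuleCat.hom_ext (LinearMap.ext fun x => ?_)
    have key : ∀ y : ∀ n : ℕ, M.K.X (i + 2 * n),
        (M.K.d i j).hom ((M.K.XIsoOfEq (show i + 2 * ((0 : ℕ) : ℤ) = i by simp)).hom.hom (y 0)) =
        (M.K.XIsoOfEq (show j + 2 * ((0 : ℕ) : ℤ) = j by simp)).hom.hom (M.negD i j y 0) := by
      intro y
      rw [negD_zero, ← ModuleCat.comp_apply, ← ModuleCat.comp_apply,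
        HomologicalComplex.XIsoOfEq_hom_comp_d, HomologicalComplex.d_comp_XIsoOfEq_hom]
    exact key x
end MixedComplex

section homology
variable (R : Type u) (B : Type v) [CommRing R] [Ring B] [Algebra R B]

/-- The Hochschild chain complex `C_•(B)`. -/
abbrev hochschildComplex : HomologicalComplex (ModuleCat.{max u v} R) (ComplexShape.down ℤ) :=
  (hochschildMixed R B).K

/-- The negative cyclic complex `CC⁻_•(B) = (C_•(B)[[u]], b + uB)`. -/
abbrev negCyclicComplex : HomologicalComplex (ModuleCat.{max u v} R) (ComplexShape.down ℤ) :=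
  (hochschildMixed R B).negCyclic

/-- Hochschild homology `HH_i(B)`. -/
abbrev HH (i : ℤ) : ModuleCat.{max u v} R := (hochschildComplex R B).homology i

/-- Negative cyclic homology `HC⁻_i(B)`. -/
abbrev HCneg (i : ℤ) : ModuleCat.{max u v} R := (negCyclicComplex R B).homology i

/-- The map `HC⁻_i(B) → HH_i(B)` induced by the projection `∑ bₙ uⁿ ↦ b₀`. -/
abbrev HCnegToHH (i : ℤ) : HCneg R B i ⟶ HH R B i :=
  HomologicalComplex.homologyMap (hochschildMixed R B).negProj i

end homology

end CY

end

/-! Duality bounds the projective dimension of `B` over `Bᵉ`, this bounds Hochschild homology, and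
part 1 and part 2 then hold for any mixed complex with the resulting vanishing. Since `Σ^{-d} B`
sits in cohomological degree `d`, the isomorphism `η` gives `Extⁿ(B, Bᵉ) = 0` for `n > d`. A bounded
resolution of `B` by finitely generated projectives therefore has a dual that is exact above `d`,
and descending induction from its top makes the resolution itself contractible above `d`
(`exists_contraction`). So `B` has projective dimension at most `d`
(`hasProjectiveDimensionLT_diag`); for `d < 0` this means `B = 0`. Hochschild homology is bounded
without the bar resolution. The Hochschild complex with coefficients in a bimodule `M` is defined by
recursion on its length. A bimodule section of `M ⊗ B → M` kills its positive homology when `M` is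
projective (`acyclic_of_projective`), flatness of `B` makes it exact in `M`, and dimension shifting
yields `HH_i(B) = 0` for `i > d`. Finally, `(b + uB) y = x` is solved one coefficient of `u` at a
time (`MixedComplex.exists_negD_eq`). The obstructions lie in the homology of `K` above the degree
concerned. The product total complex imposes no finiteness on `y`, so no convergence question
arises. -/

noncomputable section

namespace CY


/-! ### Calabi–Yau duality and vanishing of `Ext` with values in `Bᵉ` -/

section derived
variable {R : Type u} {B : Type v} [CommRing R] [Ring B] [Algebra R B]

section
variable [HasDerivedCategory.{w} (ModuleCat.{v} (Env R B))]

lemma isLE_rhomEnv {d : ℤ} (h : CalabiYau R B d) : (RHomEnv (diag R B)).IsLE d := by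
  have : (((DerivedCategory.singleFunctor _ 0).obj (diag R B))⟦-d⟧).IsLE d :=
    DerivedCategory.TStructure.t.isLE_shift _ 0 (-d) d
  exact DerivedCategory.TStructure.t.isLE_of_iso h.η.symm d

/-- The bound on the object of the derived category is a statement about the homology of the complex
representing it, and extension by zero from `ℕ` to `ℤ` preserves and reflects exactness in degree
`n`. -/
lemma dualComplex_exactAt {d : ℤ} (h : CalabiYau R B d) (n : ℕ) (hn : d < n) :
    (dualComplex (projectiveResolution (diag R B)).complex).ExactAt n := by
  have h1 := isLE_rhomEnv h
  rw [RHomEnv, DerivedCategory.isLE_Q_obj_iff] at h1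
  have h2 := CochainComplex.exactAt_of_isLE ((dualComplex
    (projectiveResolution (diag R B)).complex).extend ComplexShape.embeddingUpNat) d (n : ℤ) hn
  exact (HomologicalComplex.extend_exactAt_iff _ ComplexShape.embeddingUpNat (j := n) rfl).1 h2

/-- A Calabi–Yau algebra of negative dimension is zero. -/
lemma isZero_diag {d : ℤ} (h : CalabiYau R B d) (hd : d < 0) : IsZero (diag R B) := by
  -- The dual complex lives in degrees `≥ 0`. Through `η` this puts `B`, placed in degree `0`, in
  -- degrees `≥ -d > 0`, so its identity is zero by the orthogonality of the t-structure.
  have h0 : (RHomEnv (diag R B)).IsGE 0 := by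
    rw [RHomEnv, DerivedCategory.isGE_Q_obj_iff]
    infer_instance
  have h1 : (((DerivedCategory.singleFunctor _ 0).obj (diag R B))⟦-d⟧).IsGE 0 :=
    DerivedCategory.TStructure.t.isGE_of_iso h.η 0
  have h2 : ((DerivedCategory.singleFunctor _ 0).obj (diag R B)).IsGE (-d) :=
    DerivedCategory.TStructure.t.isGE_of_shift _ (-d) (-d) 0
  have h3 := DerivedCategory.TStructure.t.zero (𝟙 ((DerivedCategory.singleFunctor _ 0).obj (diag R B)))
    0 (-d)
  rw [IsZero.iff_id_eq_zero]
  apply (DerivedCategory.singleFunctor _ 0).map_injective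
  rw [Functor.map_zero, CategoryTheory.Functor.map_id, h3]
end

/-- `Bᵉ` as a left module over itself. -/
abbrev envSelf (R : Type u) (B : Type v) [CommRing R] [Ring B] [Algebra R B] :
    ModuleCat.{v} (Env R B) := ModuleCat.of (Env R B) (Env R B)

/-- Exactness depends only on the underlying groups, so the twist by `swap` in the dual disappears:
a cocycle with values in `Bᵉ` is a coboundary. -/
lemma exists_factor_of_exactAt (P : ChainComplex (ModuleCat.{v} (Env R B)) ℕ) (n : ℕ)
    (h : (dualComplex P).ExactAt (n + 1)) (f : P.X (n + 1) ⟶ envSelf R B)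
    (hf : P.d (n + 2) (n + 1) ≫ f = 0) : ∃ g : P.X n ⟶ envSelf R B, P.d (n + 1) n ≫ g = f := by
  rw [HomologicalComplex.exactAt_iff' _ n (n + 1) (n + 2) (by simp) (by simp),
    ShortComplex.moduleCat_exact_iff] at h
  obtain ⟨g, hg⟩ := h (show P.X (n + 1) →ₗ[Env R B] Env R B from f.hom)
    (congrArg ModuleCat.Hom.hom hf)
  exact ⟨ModuleCat.ofHom (show P.X n →ₗ[Env R B] Env R B from g), ModuleCat.hom_ext hg⟩
end derived

/-! ### Contracting bounded complexes of finitely generated projectives -/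

section contraction
variable {S : Type v} [Ring S]

/-- A map out of a finitely generated projective module `N` that kills the image of `f : L ⟶ N` factors
through `g : N ⟶ M`, if this holds for linear forms. -/
lemma factor_of_finite_projective {L N M Y : ModuleCat.{v} S} (f : L ⟶ N) (g : N ⟶ M)
    (H : ∀ φ : N ⟶ ModuleCat.of S S, f ≫ φ = 0 → ∃ ψ : M ⟶ ModuleCat.of S S, g ≫ ψ = φ)
    [Module.Finite S Y] [Projective Y] (e : N ⟶ Y) (he : f ≫ e = 0) : ∃ k : M ⟶ Y, g ≫ k = e := by
  obtain ⟨n, p, hp⟩ := Module.Finite.exists_fin' S Y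
  have hY : Module.Projective S Y := (IsProjective.iff_projective Y).2 inferInstance
  -- `Y` is a retract of `Sⁿ`, so `e` is recovered from its finitely many coordinates in `Sⁿ`, which
  -- are linear forms covered by `H`.
  obtain ⟨s, hs⟩ := Module.projective_lifting_property p LinearMap.id hp
  have : ∀ i, ∃ ψ : M ⟶ ModuleCat.of S S,
      g ≫ ψ = e ≫ ModuleCat.ofHom (LinearMap.proj i ∘ₗ s) := fun i =>
    H _ (by rw [← Category.assoc, he, zero_comp])
  choose ψ hψ using this
  refine ⟨ModuleCat.ofHom (p ∘ₗ LinearMap.pi fun i => (ψ i).hom), ModuleCat.hom_ext ?_⟩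
  ext x
  have : (LinearMap.pi fun i => (ψ i).hom) (g.hom x) = s (e.hom x) := by
    funext i
    exact congrArg (fun t => t.hom x) (hψ i)
  change p ((LinearMap.pi fun i => (ψ i).hom) (g.hom x)) = e.hom x
  rw [this]
  exact LinearMap.congr_fun hs _

/-- A bounded complex of finitely generated projective modules, the dual of which is exact above
degree `d`, is contractible above degree `d`. -/
lemma exists_contraction (P : ChainComplex (ModuleCat.{v} S) ℕ) (d N : ℕ)
    (hfin : ∀ n, Module.Finite S (P.X n)) (hproj : ∀ n, Projective (P.X n))
    (hN : ∀ n, N < n → IsZero (P.X n))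
    (H : ∀ n, d ≤ n → ∀ φ : P.X (n + 1) ⟶ ModuleCat.of S S, P.d (n + 2) (n + 1) ≫ φ = 0 →
      ∃ ψ : P.X n ⟶ ModuleCat.of S S, P.d (n + 1) n ≫ ψ = φ) (n : ℕ) (hn : d ≤ n) :
    ∃ (h : P.X (n + 1) ⟶ P.X (n + 2)) (k : P.X n ⟶ P.X (n + 1)),
      h ≫ P.d (n + 2) (n + 1) + P.d (n + 1) n ≫ k = 𝟙 _ := by
  by_cases hNn : N ≤ n
  -- Beyond the length of the complex the identity to be contracted is that of a zero object.
  · exact ⟨0, 0, (hN (n + 1) (by omega)).eq_of_src _ _⟩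
  · obtain ⟨h', k', hk'⟩ := exists_contraction P d N hfin hproj hN H (n + 1) (by omega)
    -- The map `k'` found one degree higher serves as the upper half of the homotopy here. What
    -- remains, `𝟙 - k' ≫ d`, kills boundaries: `d ≫ k' = 𝟙 - h' ≫ d` and `d ≫ d = 0`. It therefore
    -- factors through the differential.
    obtain ⟨k, hk⟩ := factor_of_finite_projective (P.d (n + 2) (n + 1)) (P.d (n + 1) n) (H n hn)
      (Y := P.X (n + 1)) (𝟙 _ - k' ≫ P.d (n + 2) (n + 1)) (by
        have e : P.d (n + 2) (n + 1) ≫ k' = 𝟙 _ - h' ≫ P.d (n + 3) (n + 2) := eq_sub_of_add_eq' hk'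
        rw [Preadditive.comp_sub, ← Category.assoc, e]
        simp)
    exact ⟨k', k, by rw [hk]; abel⟩
  termination_by N - n

end contraction

/-! ### Projective dimension of the diagonal bimodule -/

section dimension
variable {S : Type v} [Ring S]

open Abelian

/-- If a perfect module `M` has `Extⁿ(M, S) = 0` for `n > d`, then its projective dimension is at
most `d`. -/
lemma hasProjectiveDimensionLT_of_isPerfect (M : ModuleCat.{v} S) (hM : IsPerfect S M) (d : ℕ)
    (h : ∀ n, d < n → ∀ α : Ext.{v} M (ModuleCat.of S S) n, α = 0) :
    HasProjectiveDimensionLT M (d + 1) := by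
  obtain ⟨P, hfin, N, hN⟩ := hM
  rw [hasProjectiveDimensionLT_iff.{v}]
  intro i hi Y α
  obtain ⟨n, rfl⟩ : ∃ n, i = n + 1 := ⟨i - 1, by omega⟩
  obtain ⟨f, hf, rfl⟩ := P.extMk_surjective α (n + 2) rfl
  rw [P.extMk_eq_zero_iff _ _ _ _ n rfl]
  obtain ⟨h', k, hk⟩ := exists_contraction P.complex d N hfin P.projective hN
    (fun n hn φ hφ => (P.extMk_eq_zero_iff φ (n + 2) rfl hφ n rfl).1 (h _ (by omega) _)) n (by omega)
  -- A cocycle `f` satisfies `f = (h' ≫ d + d ≫ k) ≫ f = d ≫ (k ≫ f)`, hence is a coboundary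
  -- whatever the target `Y`.
  refine ⟨k ≫ f, ?_⟩
  rw [← Category.assoc, eq_sub_of_add_eq' hk]
  simp [hf]
end dimension

section
variable {R : Type u} {B : Type v} [CommRing R] [Ring B] [Algebra R B]
  [HasDerivedCategory.{w} (ModuleCat.{v} (Env R B))]

/-- Two resolutions occur: the chosen one that computes `RHomEnv`, and the finite one provided by
perfectness. `Ext` mediates between them: its vanishing is read off the first and used on the
second. For `d < 0` the truncation `toNat` gives the bound `0`, which says that `B = 0`. -/
lemma hasProjectiveDimensionLT_diag {d : ℤ} (h : CalabiYau R B d) :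
    HasProjectiveDimensionLT (diag R B) (d + 1).toNat := by
  rcases lt_or_ge d 0 with hd | hd
  · rw [Int.toNat_of_nonpos (by omega)]
    exact (isZero_diag h hd).hasProjectiveDimensionLT_zero
  · lift d to ℕ using hd
    refine hasProjectiveDimensionLT_of_isPerfect _ h.smooth.perfect d fun n hn α => ?_
    obtain ⟨n, rfl⟩ : ∃ m, n = m + 1 := ⟨n - 1, by omega⟩
    obtain ⟨f, hf, rfl⟩ := (projectiveResolution (diag R B)).extMk_surjective α (n + 2) rfl
    rw [ProjectiveResolution.extMk_eq_zero_iff _ _ _ _ _ n rfl]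
    exact exists_factor_of_exactAt _ _ (dualComplex_exactAt h (n + 1) (by exact_mod_cast hn)) f hf
end


/-! ### Exactness and homology isomorphisms in terms of elements -/

section concrete
variable {R : Type u} [CommRing R]

lemma exactAt_down_iff (K : HomologicalComplex (ModuleCat.{w} R) (ComplexShape.down ℤ)) {i j k : ℤ}
    (hij : i = j + 1) (hjk : j = k + 1) :
    K.ExactAt j ↔ ∀ x : K.X j, (K.d j k).hom x = 0 → ∃ y : K.X i, (K.d i j).hom y = x := by
  rw [HomologicalComplex.exactAt_iff' K i j k ((ComplexShape.down ℤ).prev_eq' hij.symm)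
    ((ComplexShape.down ℤ).next_eq' hjk.symm), ShortComplex.moduleCat_exact_iff]
  rfl

/-- A morphism of complexes of modules is an isomorphism on homology if every cycle of the target is the
image of a cycle, and every cycle that becomes a boundary is a boundary. -/
lemma isIso_homologyMap_of_lift {K L : HomologicalComplex (ModuleCat.{w} R) (ComplexShape.down ℤ)}
    (f : K ⟶ L) {i j k : ℤ} (hij : i = j + 1) (hjk : j = k + 1)
    (hs : ∀ y : L.X j, (L.d j k).hom y = 0 → ∃ x : K.X j, (K.d j k).hom x = 0 ∧ (f.f j).hom x = y)
    (hi : ∀ x : K.X j, (K.d j k).hom x = 0 → ∀ y : L.X i, (L.d i j).hom y = (f.f j).hom x →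
      ∃ z : K.X i, (K.d i j).hom z = x) :
    IsIso (HomologicalComplex.homologyMap f j) := by
  have hp : (ComplexShape.down ℤ).prev j = i := (ComplexShape.down ℤ).prev_eq' hij.symm
  have hn : (ComplexShape.down ℤ).next j = k := (ComplexShape.down ℤ).next_eq' hjk.symm
  have hcyc : ∀ (C : HomologicalComplex (ModuleCat.{w} R) (ComplexShape.down ℤ)) (x : C.X j),
      (C.d j k).hom x = 0 → ∃ c : C.cycles j, (C.iCycles j).hom c = x := by
    intro C x hx
    let g : ModuleCat.of R (LinearMap.ker (C.d j k).hom) ⟶ C.X j :=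
      ModuleCat.ofHom (LinearMap.ker (C.d j k).hom).subtype
    have hg : g ≫ C.d j k = 0 := ModuleCat.hom_ext (LinearMap.ext fun y => y.2)
    exact ⟨(C.liftCycles g k hn hg).hom ⟨x, hx⟩,
      congrArg (fun t => t.hom ⟨x, hx⟩) (C.liftCycles_i g k hn hg)⟩
  have hcyc' : ∀ (C : HomologicalComplex (ModuleCat.{w} R) (ComplexShape.down ℤ)) (c : C.cycles j),
      (C.d j k).hom ((C.iCycles j).hom c) = 0 := fun C c =>
    congrArg (fun t => t.hom c) (C.iCycles_d j k)
  have hinj : ∀ (C : HomologicalComplex (ModuleCat.{w} R) (ComplexShape.down ℤ)),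
      Function.Injective (C.iCycles j).hom := fun C =>
    (ModuleCat.mono_iff_injective _).1 inferInstance
  have hsurj : ∀ (C : HomologicalComplex (ModuleCat.{w} R) (ComplexShape.down ℤ)),
      Function.Surjective (C.homologyπ j).hom := fun C =>
    (ModuleCat.epi_iff_surjective _).1 inferInstance
  have hzero : ∀ (C : HomologicalComplex (ModuleCat.{w} R) (ComplexShape.down ℤ)) (c : C.cycles j),
      (C.homologyπ j).hom c = 0 ↔ ∃ y : C.X i, (C.d i j).hom y = (C.iCycles j).hom c := by
    intro C c
    -- Homology is the cokernel of the map from chains to cycles, so a class vanishes exactly when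
    -- its cycle is a boundary.
    have hex := ShortComplex.exact_of_g_is_cokernel
      (ShortComplex.mk _ _ (C.toCycles_comp_homologyπ i j)) (C.homologyIsCokernel i j hp)
    rw [ShortComplex.moduleCat_exact_iff] at hex
    constructor
    · intro h
      obtain ⟨y, hy⟩ := hex c h
      refine ⟨y, ?_⟩
      rw [← C.toCycles_i i j]
      exact congrArg (C.iCycles j).hom hy
    · rintro ⟨y, hy⟩
      have : (C.toCycles i j).hom y = c := hinj C (by
        rw [← hy, ← C.toCycles_i i j]; rfl)
      rw [← this]
      exact congrArg (fun t => t.hom y) (C.toCycles_comp_homologyπ i j)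
  have hi1 : ∀ c : K.cycles j, (L.iCycles j).hom ((HomologicalComplex.cyclesMap f j).hom c) =
      (f.f j).hom ((K.iCycles j).hom c) := fun c =>
    congrArg (fun t => t.hom c) (HomologicalComplex.cyclesMap_i f j)
  have hπ : ∀ c : K.cycles j, (HomologicalComplex.homologyMap f j).hom ((K.homologyπ j).hom c) =
      (L.homologyπ j).hom ((HomologicalComplex.cyclesMap f j).hom c) := fun c =>
    congrArg (fun t => t.hom c) (HomologicalComplex.homologyπ_naturality f j)
  rw [ConcreteCategory.isIso_iff_bijective]
  constructor
  · refine (injective_iff_map_eq_zero (HomologicalComplex.homologyMap f j).hom).2 fun a ha => ?_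
    obtain ⟨c, rfl⟩ := hsurj K a
    rw [hπ, hzero] at ha
    obtain ⟨y, hy⟩ := ha
    exact (hzero K c).2 (hi _ (hcyc' K c) y (hy.trans (hi1 c)))
  · intro a
    obtain ⟨c, rfl⟩ := hsurj L a
    obtain ⟨x, hx, hxc⟩ := hs _ (hcyc' L c)
    obtain ⟨c', rfl⟩ := hcyc K x hx
    refine ⟨(K.homologyπ j).hom c', (hπ c').trans ?_⟩
    congr 1
    exact hinj L ((hi1 c').trans hxc)
end concrete

/-! ### Solving equations in the negative cyclic complex -/

namespace MixedComplex
variable {R : Type u} [CommRing R] (M : MixedComplex.{w} R)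

lemma B_B (p q r : ℤ) (x : M.K.X p) : (M.B q r).hom ((M.B p q).hom x) = 0 := by
  rw [← ModuleCat.comp_apply, M.B_comp_B]; rfl

/-- A cycle `∑ xₙ uⁿ` of the negative cyclic complex is the boundary of some `∑ yₙ uⁿ` with prescribed
`y₀`, provided that `x₀ = b y₀` and the homology of `K` vanishes in degrees `i + 2, i + 4, …`. -/
lemma exists_negD_eq {i j k : ℤ} (hj : j = i + 1) (hk : i = k + 1)
    (h : ∀ n : ℕ, M.K.ExactAt (i + 2 * (n + 1 : ℕ))) (x : ∀ n : ℕ, M.K.X (i + 2 * n))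
    (hx : M.negD i k x = 0) (y₀ : M.K.X (j + 2 * (0 : ℕ)))
    (hy₀ : (M.K.d _ (i + 2 * (0 : ℕ))).hom y₀ = x 0) :
    ∃ y, M.negD j i y = x ∧ y 0 = y₀ := by
  have E : ∀ (n : ℕ) (z : M.K.X (i + 2 * (n + 1 : ℕ))),
      (M.K.d _ (k + 2 * (n + 1 : ℕ))).hom z = 0 →
      ∃ y : M.K.X (j + 2 * (n + 1 : ℕ)), (M.K.d _ (i + 2 * (n + 1 : ℕ))).hom y = z := fun n =>
    (exactAt_down_iff M.K (by rw [hj]; ring) (by rw [hk]; ring)).1 (h n)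
  -- The equation for the next coefficient is `b yₙ₊₁ = x (n + 1) - B yₙ`. From `b x (n + 1) = -B (x
  -- n)` and `bB = -Bb`, its right side has boundary `B (b yₙ - x n)`; `Q` asks that this vanish.
  let Q (n : ℕ) (y : M.K.X (j + 2 * (n : ℕ))) : Prop :=
    (M.B (i + 2 * n) (k + 2 * (n + 1 : ℕ))).hom ((M.K.d _ (i + 2 * n)).hom y - x n) = 0
  have next : ∀ (n : ℕ) (y : {y // Q n y}), ∃ y' : {y // Q (n + 1) y},
      (M.K.d (j + 2 * (n + 1 : ℕ)) (i + 2 * (n + 1 : ℕ))).hom y'.1 +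
        (M.B (j + 2 * n) (i + 2 * (n + 1 : ℕ))).hom y.1 = x (n + 1) := by
    rintro n ⟨y, hy⟩
    obtain ⟨y', hy'⟩ := E n (x (n + 1) - (M.B (j + 2 * n) (i + 2 * (n + 1 : ℕ))).hom y) (by
      have h1 := congrFun hx (n + 1)
      rw [negD_succ] at h1
      have h2 := M.anticomm_apply (i := j + 2 * n) (j := i + 2 * (n + 1 : ℕ)) (k := i + 2 * n)
        (l := k + 2 * (n + 1 : ℕ)) (by push_cast; omega) (by omega) (by push_cast; omega) y
      have h3 : (M.B (i + 2 * n) (k + 2 * (n + 1 : ℕ))).hom ((M.K.d _ (i + 2 * n)).hom y) -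
        (M.B (i + 2 * n) (k + 2 * (n + 1 : ℕ))).hom (x n) = 0 := by rw [← map_sub]; exact hy
      rw [map_sub, eq_neg_of_add_eq_zero_left h1, eq_neg_of_add_eq_zero_right h2,
        ← sub_eq_zero.1 h3]
      simp)
    refine ⟨⟨y', ?_⟩, ?_⟩
    · change (M.B _ _).hom ((M.K.d _ _).hom y' - x (n + 1)) = 0
      -- The condition propagates because `b yₙ₊₁ - x (n + 1) = -B yₙ` and `B² = 0`.
      rw [hy', sub_sub_cancel_left, map_neg, B_B, neg_zero]
    · rw [hy', sub_add_cancel]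
  choose nx hnx using next
  -- At the start `Q` holds since `b y₀ = x 0`.
  let seq (n : ℕ) : {y // Q n y} := Nat.rec ⟨y₀, by
    change (M.B _ _).hom ((M.K.d _ _).hom y₀ - x 0) = 0
    rw [hy₀, sub_self, map_zero]⟩ nx n
  refine ⟨fun n => (seq n).1, funext fun n => ?_, rfl⟩
  rcases n with _ | n
  · rw [negD_zero]; exact hy₀
  · rw [negD_succ]; exact hnx n (seq n)

/-- The constant coefficient of a cycle is a `b`-cycle in degree `i`, hence a boundary; this
supplies the `y₀` from which the other coefficients are solved. -/
lemma exactAt_negCyclic {i : ℤ} (h : ∀ j, i ≤ j → M.K.ExactAt j) : M.negCyclic.ExactAt i := by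
  rw [exactAt_down_iff (i := i + 1) (k := i - 1) _ rfl (by ring)]
  intro (x : ∀ n : ℕ, M.K.X (i + 2 * n)) (hx : M.negD i (i - 1) x = 0)
  obtain ⟨y, hy⟩ := (exactAt_down_iff M.K (i := i + 1 + 2 * (0 : ℕ)) (j := i + 2 * (0 : ℕ))
    (k := i - 1 + 2 * (0 : ℕ)) (by simp) (by simp)).1 (h _ (by simp)) (x 0) (by
      rw [← negD_zero, hx]; rfl)
  obtain ⟨z, hz, -⟩ := M.exists_negD_eq (j := i + 1) (k := i - 1) rfl (by ring)
    (fun n => h _ (by push_cast; omega)) x hx y hy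
  exact ⟨z, hz⟩

lemma isIso_homologyMap_negProj {i : ℤ} (h : ∀ j, i < j → M.K.ExactAt j) :
    IsIso (HomologicalComplex.homologyMap M.negProj i) := by
  have e (j : ℤ) : j + 2 * ((0 : ℕ) : ℤ) = j := by simp
  have hde (j k : ℤ) (y : M.K.X j) : (M.K.XIsoOfEq (e k)).inv.hom ((M.K.d j k).hom y) =
      (M.K.d _ _).hom ((M.K.XIsoOfEq (e j)).inv.hom y) := by
    rw [← ModuleCat.comp_apply, ← ModuleCat.comp_apply, HomologicalComplex.XIsoOfEq_inv_comp_d,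
      HomologicalComplex.d_comp_XIsoOfEq_inv]
  have hinv (j : ℤ) (y : M.K.X j) :
      (M.K.XIsoOfEq (e j)).hom.hom ((M.K.XIsoOfEq (e j)).inv.hom y) = y := by
    rw [← ModuleCat.comp_apply, Iso.inv_hom_id]; rfl
  have hinv' (j : ℤ) (y : M.K.X (j + 2 * ((0 : ℕ) : ℤ))) :
      (M.K.XIsoOfEq (e j)).inv.hom ((M.K.XIsoOfEq (e j)).hom.hom y) = y := by
    rw [← ModuleCat.comp_apply, Iso.hom_inv_id]; rfl
  refine isIso_homologyMap_of_lift M.negProj (i := i + 1) (j := i) (k := i - 1) rfl (by ring) ?_ ?_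
  · intro y hy
    -- Lifting a cycle of `K` means solving `(b + uB) x = 0` with prescribed `x₀`. The target degree
    -- is `i - 1`, so the obstructions lie in degrees `i + 1, i + 3, …`.
    obtain ⟨x, hx, hx0⟩ := M.exists_negD_eq (j := i) (i := i - 1) (k := i - 2) (by ring) (by ring)
      (fun n => h _ (by push_cast; omega)) 0 (map_zero _) ((M.K.XIsoOfEq (e i)).inv.hom y) (by
        rw [← hde, hy, map_zero]; rfl)
    refine ⟨x, hx, ?_⟩
    change (M.K.XIsoOfEq (e i)).hom.hom (x 0) = y
    rw [hx0, hinv]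
  · intro (x : ∀ n : ℕ, M.K.X (i + 2 * n)) (hx : M.negD i (i - 1) x = 0) y hy
    -- A primitive of `x₀` extends to a primitive of `x`; here the obstructions lie in degrees `i +
    -- 2, i + 4, …`.
    obtain ⟨z, hz, -⟩ := M.exists_negD_eq (j := i + 1) (i := i) (k := i - 1) rfl (by ring)
      (fun n => h _ (by push_cast; omega)) x hx ((M.K.XIsoOfEq (e (i + 1))).inv.hom y) (by
        rw [← hde, hy]; exact hinv' _ _)
    exact ⟨z, hz⟩
end MixedComplex


/-! ### Hochschild homology with coefficients in a bimodule -/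

section coefficients
variable {R : Type u} {B : Type v} [CommRing R] [Ring B] [Algebra R B]

instance restrictModule (M : ModuleCat.{v} (Env R B)) : Module R M :=
  Module.restrictScalars R (Env R B) M

instance restrictTower (M : ModuleCat.{v} (Env R B)) : IsScalarTower R (Env R B) M :=
  IsScalarTower.restrictScalars R (Env R B) M

/-- A morphism of `Bᵉ`-modules as an `R`-linear map. -/
abbrev linR {M N : ModuleCat.{v} (Env R B)} (f : M ⟶ N) : M →ₗ[R] N := f.hom.restrictScalars R

/-- The action of `Bᵉ` on `M ⊗_R B` by `(b ⊗ c)(m ⊗ x) = bm ⊗ xc`. -/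
def tensAct (M : ModuleCat.{v} (Env R B)) : Env R B →ₐ[R] Module.End R (M ⊗[R] B) :=
  Algebra.TensorProduct.lift
    ((Module.End.rTensorAlgHom R M B).comp
      ((Algebra.lsmul R R M).comp (Algebra.TensorProduct.includeLeft : B →ₐ[R] Env R B)))
    ((Module.End.lTensorAlgHom R B M).comp (Algebra.lsmul R R B : Bᵐᵒᵖ →ₐ[R] Module.End R B))
    (fun b c => by
      refine TensorProduct.ext' fun m x => ?_
      rfl)

/-- The type underlying `M ⊗_R B`. -/
def Tens (M : ModuleCat.{v} (Env R B)) : Type v := M ⊗[R] B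

instance (M : ModuleCat.{v} (Env R B)) : AddCommGroup (Tens M) :=
  inferInstanceAs (AddCommGroup (M ⊗[R] B))

/-- On `M ⊗[R] B` itself `Bᵉ` already acts through `M` alone; the type synonym keeps that action
apart from this outer one. -/
instance (M : ModuleCat.{v} (Env R B)) : Module (Env R B) (Tens M) :=
  Module.compHom (M ⊗[R] B) (tensAct M).toRingHom

/-- The `Bᵉ`-module `M ⊗_R B`, with left action on `M` and right action on `B`. -/
def tensObj (M : ModuleCat.{v} (Env R B)) : ModuleCat.{v} (Env R B) := ModuleCat.of (Env R B) (Tens M)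

/-- `M ⊗_R B` with its standard `R`-module structure. -/
def tensEquiv (M : ModuleCat.{v} (Env R B)) : (M ⊗[R] B) ≃ₗ[R] tensObj M where
  toFun x := x
  invFun x := x
  left_inv _ := rfl
  right_inv _ := rfl
  map_add' _ _ := rfl
  map_smul' r x := by
    change r • x = (tensAct M) (algebraMap R (Env R B) r) x
    rw [AlgHom.commutes]
    rfl

/-- The element `m ⊗ x` of `M ⊗_R B`. -/
def tmk (M : ModuleCat.{v} (Env R B)) (m : M) (x : B) : tensObj M := tensEquiv M (m ⊗ₜ x)

lemma smul_tmk (M : ModuleCat.{v} (Env R B)) (b : B) (c : Bᵐᵒᵖ) (m : M) (x : B) :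
    (b ⊗ₜ[R] c : Env R B) • tmk M m x = tmk M ((b ⊗ₜ[R] (1 : Bᵐᵒᵖ) : Env R B) • m) (x * c.unop) := by
  change tensAct M (b ⊗ₜ c) (m ⊗ₜ x) = (_ ⊗ₜ _ : M ⊗[R] B)
  exact LinearMap.congr_fun (Algebra.TensorProduct.lift_tmul _ _ _ b c) (m ⊗ₜ x)

lemma tens_ext {M : ModuleCat.{v} (Env R B)} {N : Type*} [AddCommGroup N] [Module R N]
    {f g : tensObj M →ₗ[R] N} (h : ∀ m x, f (tmk M m x) = g (tmk M m x)) : f = g := by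
  have : f ∘ₗ (tensEquiv M).toLinearMap = g ∘ₗ (tensEquiv M).toLinearMap :=
    TensorProduct.ext' h
  ext x
  obtain ⟨y, rfl⟩ := (tensEquiv M).surjective x
  exact LinearMap.congr_fun this y

/-- An `R`-linear map on `M ⊗_R B` that respects the two actions of `B` is a morphism of `Bᵉ`-modules. -/
def tensHom {M N : ModuleCat.{v} (Env R B)} (f : tensObj M →ₗ[R] N)
    (h : ∀ (b : B) (c : Bᵐᵒᵖ) (m : M) (x : B),
      f ((b ⊗ₜ[R] c : Env R B) • tmk M m x) = (b ⊗ₜ[R] c : Env R B) • f (tmk M m x)) : tensObj M ⟶ N :=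
  ModuleCat.ofHom
    { toFun := f
      map_add' := f.map_add
      map_smul' := by
        intro e y
        induction e using TensorProduct.induction_on with
        | zero =>
          exact (congrArg f (zero_smul (Env R B) y)).trans
            ((map_zero f).trans (zero_smul (Env R B) (f y)).symm)
        | add e e' he he' =>
          refine (congrArg f (add_smul e e' y)).trans ((map_add f _ _).trans ?_)
          exact (congrArg₂ (· + ·) he he').trans (add_smul e e' (f y)).symm
        | tmul b c =>
          have : f ∘ₗ Algebra.lsmul R R (tensObj M) (b ⊗ₜ[R] c : Env R B) =
              Algebra.lsmul R R N (b ⊗ₜ[R] c : Env R B) ∘ₗ f := tens_ext (h b c)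
          exact LinearMap.congr_fun this y }

lemma tensHom_apply {M N : ModuleCat.{v} (Env R B)} (f : tensObj M →ₗ[R] N) (h) (y : tensObj M) :
    (tensHom f h).hom y = f y := rfl

/-- The linear map on `M ⊗_R B` given by a bilinear map. -/
def tensLift {M : ModuleCat.{v} (Env R B)} {N : Type*} [AddCommGroup N] [Module R N]
    (f : M →ₗ[R] B →ₗ[R] N) : tensObj M →ₗ[R] N :=
  TensorProduct.lift f ∘ₗ (tensEquiv M).symm.toLinearMap

lemma tensLift_tmk {M : ModuleCat.{v} (Env R B)} {N : Type*} [AddCommGroup N] [Module R N]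
    (f : M →ₗ[R] B →ₗ[R] N) (m : M) (x : B) : tensLift f (tmk M m x) = f m x := by
  simp [tensLift, tmk]

/-- The functoriality of `M ⊗_R B` in `M`. -/
def tensMap {M N : ModuleCat.{v} (Env R B)} (f : M ⟶ N) : tensObj M ⟶ tensObj N :=
  tensHom ((tensEquiv N).toLinearMap ∘ₗ (linR f).rTensor B ∘ₗ (tensEquiv M).symm.toLinearMap) (by
    have key : ∀ (m : M) (x : B), ((tensEquiv N).toLinearMap ∘ₗ (linR f).rTensor B ∘ₗ
        (tensEquiv M).symm.toLinearMap) (tmk M m x) = tmk N (f.hom m) x := by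
      intro m x; simp [tmk]
    intro b c m x
    rw [smul_tmk, key, key, smul_tmk, map_smul])

lemma tensMap_tmk {M N : ModuleCat.{v} (Env R B)} (f : M ⟶ N) (m : M) (x : B) :
    (tensMap f).hom (tmk M m x) = tmk N (f.hom m) x := by
  simp [tensMap, tensHom_apply, tmk]

lemma tensHom_ext {M N : ModuleCat.{v} (Env R B)} {f g : tensObj M ⟶ N}
    (h : ∀ m x, f.hom (tmk M m x) = g.hom (tmk M m x)) : f = g :=
  ModuleCat.hom_ext (LinearMap.restrictScalars_injective R (tens_ext h))

lemma tensMap_comp {M N P : ModuleCat.{v} (Env R B)} (f : M ⟶ N) (g : N ⟶ P) :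
    tensMap (f ≫ g) = tensMap f ≫ tensMap g :=
  tensHom_ext fun m x => by simp [tensMap_tmk]

lemma tensMap_id (M : ModuleCat.{v} (Env R B)) : tensMap (𝟙 M) = 𝟙 _ :=
  tensHom_ext fun m x => by simp [tensMap_tmk]

/-- The right action `m ⊗ x ↦ mx`. -/
def rightAct (M : ModuleCat.{v} (Env R B)) : tensObj M ⟶ M :=
  tensHom (tensLift (LinearMap.mk₂ R
      (fun (m : M) (x : B) => ((1 : B) ⊗ₜ[R] MulOpposite.op x : Env R B) • m)
      (by simp) (fun r m x => (smul_comm r _ m).symm) (by simp [tmul_add, add_smul])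
      (by simp [smul_assoc]))) (by
    intro b c m x
    rw [smul_tmk, tensLift_tmk, tensLift_tmk, LinearMap.mk₂_apply, LinearMap.mk₂_apply,
      smul_smul, smul_smul]
    simp)

lemma rightAct_tmk (M : ModuleCat.{v} (Env R B)) (m : M) (x : B) :
    (rightAct M).hom (tmk M m x) = ((1 : B) ⊗ₜ[R] MulOpposite.op x : Env R B) • m :=
  tensLift_tmk _ _ _

/-- The left action `m ⊗ x ↦ xm`. -/
def leftAct (M : ModuleCat.{v} (Env R B)) : tensObj M →ₗ[R] M :=
  tensLift (LinearMap.mk₂ R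
    (fun (m : M) (x : B) => (x ⊗ₜ[R] (1 : Bᵐᵒᵖ) : Env R B) • m)
    (by simp) (fun r m x => (smul_comm r _ m).symm) (by simp [add_tmul, add_smul])
    (by simp [← smul_tmul', smul_assoc]))

lemma leftAct_tmk (M : ModuleCat.{v} (Env R B)) (m : M) (x : B) :
    leftAct M (tmk M m x) = (x ⊗ₜ[R] (1 : Bᵐᵒᵖ) : Env R B) • m :=
  tensLift_tmk _ _ _

lemma rightAct_surjective (M : ModuleCat.{v} (Env R B)) : Function.Surjective (rightAct M).hom :=
  fun m => ⟨tmk M m 1, by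
    rw [rightAct_tmk]
    exact one_smul (Env R B) m⟩

lemma rightAct_naturality {M N : ModuleCat.{v} (Env R B)} (f : M ⟶ N) :
    tensMap f ≫ rightAct N = rightAct M ≫ f := by
  refine tensHom_ext fun m x => ?_
  rw [ModuleCat.comp_apply, ModuleCat.comp_apply, tensMap_tmk, rightAct_tmk, rightAct_tmk, map_smul]

lemma leftAct_naturality {M N : ModuleCat.{v} (Env R B)} (f : M ⟶ N) :
    leftAct N ∘ₗ linR (tensMap f) = linR f ∘ₗ leftAct M := by
  refine tens_ext fun m x => ?_
  change leftAct N ((tensMap f).hom (tmk M m x)) = f.hom (leftAct M (tmk M m x))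
  rw [tensMap_tmk, leftAct_tmk, leftAct_tmk, map_smul]

/-- Both sides send `m ⊗ x ⊗ z` to `xzm`. This associativity is the base case of `b² = 0`. -/
lemma leftAct_leftAct (M : ModuleCat.{v} (Env R B)) :
    leftAct M ∘ₗ leftAct (tensObj M) = leftAct M ∘ₗ linR (rightAct (tensObj M)) := by
  refine tens_ext fun y z => ?_
  change (leftAct M ∘ₗ leftAct (tensObj M)) (tmk _ y z) =
    leftAct M ((rightAct (tensObj M)).hom (tmk _ y z))
  rw [LinearMap.comp_apply, leftAct_tmk, rightAct_tmk]
  have : leftAct M ∘ₗ Algebra.lsmul R R (tensObj M) (z ⊗ₜ[R] 1 : Env R B) =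
      leftAct M ∘ₗ Algebra.lsmul R R (tensObj M) (1 ⊗ₜ[R] MulOpposite.op z : Env R B) := by
    refine tens_ext fun m x => ?_
    simp only [LinearMap.comp_apply, Algebra.lsmul_coe]
    rw [smul_tmk, smul_tmk]
    erw [leftAct_tmk, leftAct_tmk]
    rw [smul_smul, smul_smul]
    simp
  exact LinearMap.congr_fun this y

/-- The `Bᵉ`-module `M ⊗_R B^{⊗n}`, with left action on `M` and right action on the last factor. -/
def tensPow : ℕ → ModuleCat.{v} (Env R B) → ModuleCat.{v} (Env R B)
  | 0, M => M
  | n + 1, M => tensPow n (tensObj M)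

/-- The functoriality of `M ⊗_R B^{⊗n}` in `M`. -/
def tensPowMap : ∀ (n : ℕ) {M N : ModuleCat.{v} (Env R B)}, (M ⟶ N) → (tensPow n M ⟶ tensPow n N)
  | 0, _, _, f => f
  | n + 1, _, _, f => tensPowMap n (tensMap f)

lemma tensPowMap_comp (n : ℕ) {M N P : ModuleCat.{v} (Env R B)} (f : M ⟶ N) (g : N ⟶ P) :
    tensPowMap n (f ≫ g) = tensPowMap n f ≫ tensPowMap n g := by
  induction n generalizing M N P with
  | zero => rfl
  | succ n ih => exact (congrArg (tensPowMap n) (tensMap_comp f g)).trans (ih _ _)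

lemma tensPowMap_id (n : ℕ) (M : ModuleCat.{v} (Env R B)) : tensPowMap n (𝟙 M) = 𝟙 _ := by
  induction n generalizing M with
  | zero => rfl
  | succ n ih => exact (congrArg (tensPowMap n) (tensMap_id M)).trans (ih _)

/-- The identification `M ⊗ B^{⊗0} = M`. -/
def tensPowZero (M : ModuleCat.{v} (Env R B)) : M ≃ₗ[R] tensPow 0 M := LinearEquiv.refl R M

/-- The identification `(M ⊗ B) ⊗ B^{⊗n} = M ⊗ B^{⊗(n+1)}`. -/
def tensPowSucc (n : ℕ) (M : ModuleCat.{v} (Env R B)) :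
    tensPow n (tensObj M) ≃ₗ[R] tensPow (n + 1) M :=
  LinearEquiv.refl R (tensPow n (tensObj M))

lemma tensPowMap_zero {M N : ModuleCat.{v} (Env R B)} (f : M ⟶ N) (x : M) :
    (tensPowMap 0 f).hom (tensPowZero M x) = tensPowZero N (f.hom x) := rfl

lemma tensPowMap_succ (n : ℕ) {M N : ModuleCat.{v} (Env R B)} (f : M ⟶ N)
    (x : tensPow n (tensObj M)) :
    (tensPowMap (n + 1) f).hom (tensPowSucc n M x) =
      tensPowSucc n N ((tensPowMap n (tensMap f)).hom x) := rfl

/-- The Hochschild differential `M ⊗ B^{⊗(n+1)} → M ⊗ B^{⊗n}` with coefficients in `M`. -/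
def coeffDiff : ∀ (n : ℕ) (M : ModuleCat.{v} (Env R B)), tensPow (n + 1) M →ₗ[R] tensPow n M
  | 0, M => (tensPowZero M).toLinearMap ∘ₗ (linR (rightAct M) - leftAct M) ∘ₗ
      (tensPowZero _).symm.toLinearMap ∘ₗ (tensPowSucc 0 M).symm.toLinearMap
  | n + 1, M => (linR (tensPowMap (n + 1) (rightAct M)) -
      (tensPowSucc n M).toLinearMap ∘ₗ coeffDiff n (tensObj M)) ∘ₗ
      (tensPowSucc (n + 1) M).symm.toLinearMap

lemma coeffDiff_zero (M : ModuleCat.{v} (Env R B)) (x : tensObj M) :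
    coeffDiff 0 M (tensPowSucc 0 M (tensPowZero _ x)) =
      tensPowZero M ((rightAct M).hom x - leftAct M x) := rfl

/-- The first face multiplies into `M` from the right; the remaining faces are, with opposite sign,
those of the complex with coefficients in `M ⊗ B`. This recursion replaces manipulations of
alternating sums. -/
lemma coeffDiff_succ (n : ℕ) (M : ModuleCat.{v} (Env R B)) (x : tensPow (n + 1) (tensObj M)) :
    coeffDiff (n + 1) M (tensPowSucc (n + 1) M x) = (tensPowMap (n + 1) (rightAct M)).hom x -
      tensPowSucc n M (coeffDiff n (tensObj M) x) := rfl

lemma coeffDiff_naturality (n : ℕ) {M N : ModuleCat.{v} (Env R B)} (f : M ⟶ N)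
    (x : tensPow (n + 1) M) :
    coeffDiff n N ((tensPowMap (n + 1) f).hom x) = (tensPowMap n f).hom (coeffDiff n M x) := by
  induction n generalizing M N with
  | zero =>
    obtain ⟨x, rfl⟩ := (tensPowSucc 0 M).surjective x
    obtain ⟨x, rfl⟩ := (tensPowZero _).surjective x
    rw [tensPowMap_succ, tensPowMap_zero, coeffDiff_zero, coeffDiff_zero, tensPowMap_zero]
    have h1 : (rightAct N).hom ((tensMap f).hom x) = f.hom ((rightAct M).hom x) :=
      congrArg (fun t => t.hom x) (rightAct_naturality f)
    have h2 : leftAct N ((tensMap f).hom x) = f.hom (leftAct M x) :=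
      LinearMap.congr_fun (leftAct_naturality f) x
    rw [h1, h2, ← map_sub]
  | succ n ih =>
    obtain ⟨x, rfl⟩ := (tensPowSucc (n + 1) M).surjective x
    rw [tensPowMap_succ, coeffDiff_succ, coeffDiff_succ, map_sub, ih, tensPowMap_succ]
    congr 1
    rw [← ModuleCat.comp_apply, ← ModuleCat.comp_apply, ← tensPowMap_comp, ← tensPowMap_comp,
      rightAct_naturality]

/-- Write `b = r - b'`, with `r` induced by the right action and `b'` the differential with
coefficients in `M ⊗ B`. Naturality gives `b r = r b'`, so `b² = r b' - (r - b') b' = b'²`, which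
vanishes by induction on the length. -/
lemma coeffDiff_coeffDiff (n : ℕ) (M : ModuleCat.{v} (Env R B)) (x : tensPow (n + 2) M) :
    coeffDiff n M (coeffDiff (n + 1) M x) = 0 := by
  induction n generalizing M with
  | zero =>
    obtain ⟨x, rfl⟩ := (tensPowSucc 1 M).surjective x
    obtain ⟨x, rfl⟩ := (tensPowSucc 0 _).surjective x
    obtain ⟨x, rfl⟩ := (tensPowZero _).surjective x
    rw [coeffDiff_succ, map_sub, coeffDiff_naturality, coeffDiff_zero, coeffDiff_zero,
      tensPowMap_zero, ← map_sub, sub_sub_cancel, map_sub, sub_eq_zero.2, map_zero]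
    exact (LinearMap.congr_fun (leftAct_leftAct M) x).symm
  | succ n ih =>
    obtain ⟨x, rfl⟩ := (tensPowSucc (n + 2) M).surjective x
    rw [coeffDiff_succ, map_sub, coeffDiff_naturality, coeffDiff_succ, sub_sub_cancel, ih, map_zero]

/-- The vanishing of the Hochschild homology in degree `n + 1` with coefficients in `M`. -/
def Acyclic (n : ℕ) (M : ModuleCat.{v} (Env R B)) : Prop :=
  ∀ x, coeffDiff n M x = 0 → ∃ y, coeffDiff (n + 1) M y = x

/-- The right action `M ⊗ B → M` is a surjection of bimodules, so it has a bimodule section `σ`. For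
a cycle `x` the recursion and naturality give `b (σ x) = x - σ (b x) = x`. -/
lemma acyclic_of_projective (n : ℕ) (M : ModuleCat.{v} (Env R B)) [Projective M] : Acyclic n M := by
  intro x hx
  have : Epi (rightAct M) := (ModuleCat.epi_iff_surjective _).2 (rightAct_surjective M)
  let σ : M ⟶ tensObj M := Projective.factorThru (𝟙 M) (rightAct M)
  have hσ : σ ≫ rightAct M = 𝟙 M := Projective.factorThru_comp _ _
  refine ⟨tensPowSucc (n + 1) M ((tensPowMap (n + 1) σ).hom x), ?_⟩
  rw [coeffDiff_succ, coeffDiff_naturality, hx, map_zero, map_zero, sub_zero,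
    ← ModuleCat.comp_apply, ← tensPowMap_comp, hσ, tensPowMap_id]
  rfl

/-- `K → P → M` is a short exact sequence. -/
structure IsShortExact {K P M : ModuleCat.{v} (Env R B)} (i : K ⟶ P) (p : P ⟶ M) : Prop where
  injective : Function.Injective i.hom
  exact : Function.Exact i.hom p.hom
  surjective : Function.Surjective p.hom

namespace IsShortExact
variable [Module.Flat R B] {K P M : ModuleCat.{v} (Env R B)} {i : K ⟶ P} {p : P ⟶ M}

protected lemma tensMap (h : IsShortExact i p) : IsShortExact (tensMap i) (tensMap p) :=
  ⟨Module.Flat.rTensor_preserves_injective_linearMap (M := B) (linR i) h.injective,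
    rTensor_exact B (f := linR i) (g := linR p) h.exact h.surjective,
    LinearMap.rTensor_surjective B (g := linR p) h.surjective⟩

protected lemma tensPowMap (h : IsShortExact i p) (n : ℕ) :
    IsShortExact (tensPowMap n i) (tensPowMap n p) := by
  induction n generalizing K P M with
  | zero => exact h
  | succ n ih => exact ih h.tensMap

/-- Dimension shifting. -/
lemma acyclic (h : IsShortExact i p) (n : ℕ) (hP : Acyclic (n + 1) P) (hK : Acyclic n K) :
    Acyclic (n + 1) M := by
  intro x hx
  -- The connecting-map chase: lift the cycle to `y`, write `b y` as the image of a cycle `z` of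
  -- `K`, write `z = b t`, and correct `y` by `t` to a cycle of `P`. The correction is invisible in
  -- `M`.
  obtain ⟨y, rfl⟩ := (h.tensPowMap (n + 2)).surjective x
  rw [coeffDiff_naturality] at hx
  obtain ⟨z, hz⟩ := ((h.tensPowMap (n + 1)).exact _).1 hx
  have hz0 : coeffDiff n K z = 0 := by
    apply (h.tensPowMap n).injective
    rw [← coeffDiff_naturality, hz, coeffDiff_coeffDiff, map_zero]
  obtain ⟨t, rfl⟩ := hK z hz0
  rw [← coeffDiff_naturality] at hz
  obtain ⟨s, hs⟩ := hP (y - (tensPowMap (n + 2) i).hom t) (by rw [map_sub, hz, sub_self])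
  refine ⟨(tensPowMap (n + 3) p).hom s, ?_⟩
  rw [coeffDiff_naturality, hs, map_sub, (h.tensPowMap (n + 2)).exact.apply_apply_eq_zero, sub_zero]
end IsShortExact

/-- Passing to the kernel of a projective cover term `P → M` lowers both the projective dimension
and the homological degree by one, until the module is projective. -/
lemma acyclic_of_hasProjectiveDimensionLT [Module.Flat R B] (k n : ℕ) (hn : k ≤ n)
    (M : ModuleCat.{v} (Env R B)) [HasProjectiveDimensionLT M (k + 1)] : Acyclic n M := by
  induction k generalizing n M with
  | zero =>
    have : Projective M := projective_iff_hasProjectiveDimensionLT_one.2 ‹_›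
    exact acyclic_of_projective n M
  | succ k ih =>
    obtain ⟨n, rfl⟩ : ∃ m, n = m + 1 := ⟨n - 1, by omega⟩
    let S : ShortComplex (ModuleCat.{v} (Env R B)) :=
      ShortComplex.mk _ _ (kernel.condition (Projective.π M))
    have hS : S.ShortExact :=
      { exact := ShortComplex.exact_of_f_is_kernel S (kernelIsKernel (Projective.π M))
        mono_f := inferInstanceAs (Mono (kernel.ι _))
        epi_g := inferInstanceAs (Epi (Projective.π M)) }
    have hproj : Projective S.X₂ := inferInstanceAs (Projective (Projective.over M))
    have : HasProjectiveDimensionLT S.X₁ (k + 1) :=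
      (hS.hasProjectiveDimensionLT_X₃_iff k hproj).1 ‹_›
    have h : IsShortExact S.f S.g := ⟨hS.moduleCat_injective_f,
      (ShortComplex.ShortExact.moduleCat_exact_iff_function_exact S).1 hS.exact,
      hS.moduleCat_surjective_g⟩
    exact h.acyclic n (acyclic_of_projective _ S.X₂) (ih n (by omega) S.X₁)
end coefficients


/-! ### Comparison with Hochschild chains as tuples, and the vanishing theorem -/

section comparison
variable {R : Type u} {B : Type v} [CommRing R] [Ring B] [Algebra R B]

variable (R B) in
/-- The isomorphism `B ⊗ B^{⊗n} ≅ B^{⊗(n+1)}`. -/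
def tensorCons (n : ℕ) : (B ⊗[R] (⨂[R] (_ : Fin n), B)) ≃ₗ[R] ⨂[R] (_ : Fin (n + 1)), B :=
  ((TensorProduct.congr (PiTensorProduct.subsingletonEquiv (s := fun _ : Fin 1 => B) 0).symm
    (LinearEquiv.refl R _)).trans (PiTensorProduct.tmulEquiv R B)).trans
    (PiTensorProduct.reindex R (fun _ => B) (finSumFinEquiv.trans (finCongr (add_comm 1 n))))

lemma tensorCons_tmul (n : ℕ) (b : B) (a : Fin n → B) :
    tensorCons R B n (b ⊗ₜ PiTensorProduct.tprod R a) =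
      PiTensorProduct.tprod R (Fin.cons b a : Fin (n + 1) → B) := by
  have h : (PiTensorProduct.subsingletonEquiv (R := R) (s := fun _ : Fin 1 => B) 0).symm b =
      PiTensorProduct.tprod R (fun _ => b) :=
    PiTensorProduct.subsingletonEquiv_symm_apply' _ _
  simp only [tensorCons, LinearEquiv.trans_apply, TensorProduct.congr_tmul, h,
    LinearEquiv.refl_apply, PiTensorProduct.tmulEquiv_apply, PiTensorProduct.reindex_tprod]
  congr 1
  funext k
  refine Fin.cases ?_ (fun k => ?_) k
  · have : (finSumFinEquiv.trans (finCongr (add_comm 1 n))).symm 0 = Sum.inl 0 := by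
      rw [Equiv.symm_apply_eq]; rfl
    rw [this]; rfl
  · have : (finSumFinEquiv.trans (finCongr (add_comm 1 n))).symm k.succ = Sum.inr k := by
      rw [Equiv.symm_apply_eq]; ext; simp
    rw [this]; rfl

/-- The element `m ⊗ a₀ ⊗ … ⊗ aₙ₋₁` of `M ⊗ B^{⊗n}`. -/
def pureTensor : ∀ (n : ℕ) (M : ModuleCat.{v} (Env R B)), M → (Fin n → B) → tensPow n M
  | 0, M, m, _ => tensPowZero M m
  | n + 1, M, m, a => tensPowSucc n M (pureTensor n (tensObj M) (tmk M m (a 0)) (Fin.tail a))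

lemma pureTensor_zero (M : ModuleCat.{v} (Env R B)) (m : M) (a : Fin 0 → B) :
    pureTensor 0 M m a = tensPowZero M m := rfl

lemma pureTensor_succ (n : ℕ) (M : ModuleCat.{v} (Env R B)) (m : M) (a : Fin (n + 1) → B) :
    pureTensor (n + 1) M m a =
      tensPowSucc n M (pureTensor n (tensObj M) (tmk M m (a 0)) (Fin.tail a)) := rfl

lemma pureTensor_cons (n : ℕ) (M : ModuleCat.{v} (Env R B)) (m : M) (x : B) (a : Fin n → B) :
    pureTensor (n + 1) M m (Fin.cons x a) =
      tensPowSucc n M (pureTensor n (tensObj M) (tmk M m x) a) := by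
  rw [pureTensor_succ, Fin.cons_zero, Fin.tail_cons]

/-- The isomorphism of `M ⊗ B^{⊗n}` with the iterated tensor product. -/
def tensPowEquiv : ∀ (n : ℕ) (M : ModuleCat.{v} (Env R B)),
    (M ⊗[R] (⨂[R] (_ : Fin n), B)) ≃ₗ[R] tensPow n M
  | 0, M => ((TensorProduct.congr (LinearEquiv.refl R M)
      (PiTensorProduct.isEmptyEquiv (R := R) (s := fun _ => B) (Fin 0))).trans
        (TensorProduct.rid R M)).trans (tensPowZero M)
  | n + 1, M => ((TensorProduct.congr (LinearEquiv.refl R M) (tensorCons R B n).symm).trans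
      (TensorProduct.assoc R M B _).symm).trans
      ((TensorProduct.congr (tensEquiv M) (LinearEquiv.refl R _)).trans
        ((tensPowEquiv n (tensObj M)).trans (tensPowSucc n M)))

lemma tensPowEquiv_tmul (n : ℕ) (M : ModuleCat.{v} (Env R B)) (m : M) (a : Fin n → B) :
    tensPowEquiv n M (m ⊗ₜ PiTensorProduct.tprod R a) = pureTensor n M m a := by
  induction n generalizing M with
  | zero => simp [tensPowEquiv, pureTensor_zero]
  | succ n ih =>
    have h : (tensorCons R B n).symm (PiTensorProduct.tprod R a) =
        a 0 ⊗ₜ PiTensorProduct.tprod R (Fin.tail a) := by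
      rw [LinearEquiv.symm_apply_eq, tensorCons_tmul, Fin.cons_self_tail]
    simp only [tensPowEquiv, LinearEquiv.trans_apply, TensorProduct.congr_tmul, h,
      LinearEquiv.refl_apply, TensorProduct.assoc_symm_tmul]
    exact congrArg (tensPowSucc n M) (ih (tensObj M) (tmk M m (a 0)) (Fin.tail a))

lemma tensPowMap_pureTensor (n : ℕ) {M N : ModuleCat.{v} (Env R B)} (f : M ⟶ N) (m : M)
    (a : Fin n → B) : (tensPowMap n f).hom (pureTensor n M m a) = pureTensor n N (f.hom m) a := by
  induction n generalizing M N with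
  | zero => rfl
  | succ n ih => rw [pureTensor_succ, tensPowMap_succ, ih, tensMap_tmk, pureTensor_succ]

/-- The tuple `(a₀, …, aᵢaᵢ₊₁, …, aₙ)`, for `i < n`. -/
def contract {n : ℕ} (i : ℕ) (a : Fin (n + 1) → B) : Fin n → B :=
  fun k => if k.val < i then a k.castSucc
    else if k.val = i then a k.castSucc * a k.succ else a k.succ

lemma contract_zero {n : ℕ} (a : Fin (n + 2) → B) :
    contract 0 a = Fin.cons (a 0 * a 1) (Fin.tail (Fin.tail a)) := by
  funext k
  refine Fin.cases ?_ (fun k => ?_) k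
  · simp [contract]
  · simp [contract, Fin.tail]

lemma contract_succ {n : ℕ} (i : ℕ) (a : Fin (n + 2) → B) :
    contract (i + 1) a = Fin.cons (a 0) (contract i (Fin.tail a)) := by
  funext k
  refine Fin.cases ?_ (fun k => ?_) k
  · simp [contract]
  · simp [contract, Fin.tail]

/-- The explicit formula for the Hochschild differential with coefficients. -/
lemma coeffDiff_pureTensor (n : ℕ) (M : ModuleCat.{v} (Env R B)) (m : M) (a : Fin (n + 1) → B) :
    coeffDiff n M (pureTensor (n + 1) M m a) =
      pureTensor n M (((1 : B) ⊗ₜ[R] MulOpposite.op (a 0) : Env R B) • m) (Fin.tail a) +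
      ∑ i ∈ Finset.range n, (-1 : R) ^ (i + 1) • pureTensor n M m (contract i a) +
      (-1 : R) ^ (n + 1) • pureTensor n M ((a (Fin.last n) ⊗ₜ[R] (1 : Bᵐᵒᵖ) : Env R B) • m)
        (Fin.init a) := by
  induction n generalizing M with
  | zero =>
    rw [pureTensor_succ, pureTensor_zero, coeffDiff_zero, rightAct_tmk, leftAct_tmk, map_sub,
      Finset.range_zero, Finset.sum_empty, add_zero, pureTensor_zero, pureTensor_zero, sub_eq_add_neg]
    congr 1
    simp
  | succ n ih =>
    -- The first face with coefficients in `M ⊗ B` multiplies `a 1` into `a 0`, so it becomes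
    -- `contract 0`. The other contractions shift by one and the last face still acts on `m`; the
    -- minus sign of the recursion accounts for the shift of exponents.
    rw [pureTensor_succ, coeffDiff_succ, tensPowMap_pureTensor, rightAct_tmk, ih, map_add, map_add,
      map_sum, Finset.sum_range_succ', smul_tmk, smul_tmk, ← pureTensor_cons, map_smul,
      ← pureTensor_cons]
    have e0 : (((1 : B) ⊗ₜ[R] (1 : Bᵐᵒᵖ) : Env R B) • m) = m := one_smul (Env R B) m
    have h1 : pureTensor (n + 1) M (((1 : B) ⊗ₜ[R] (1 : Bᵐᵒᵖ) : Env R B) • m)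
        (Fin.cons (a 0 * (MulOpposite.op (Fin.tail a 0)).unop) (Fin.tail (Fin.tail a))) =
        pureTensor (n + 1) M m (contract 0 a) := by
      rw [e0, contract_zero]; rfl
    have h2 : pureTensor (n + 1) M ((Fin.tail a (Fin.last n) ⊗ₜ[R] (1 : Bᵐᵒᵖ) : Env R B) • m)
        (Fin.cons (a 0 * (1 : Bᵐᵒᵖ).unop) (Fin.init (Fin.tail a))) =
        pureTensor (n + 1) M ((a (Fin.last (n + 1)) ⊗ₜ[R] (1 : Bᵐᵒᵖ) : Env R B) • m)
          (Fin.init a) := by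
      rw [MulOpposite.unop_one, mul_one, ← Fin.tail_init_eq_init_tail]
      congr 1
      exact Fin.cons_self_tail (Fin.init a)
    have h3 : ∑ i ∈ Finset.range n, tensPowSucc n M
          ((-1 : R) ^ (i + 1) • pureTensor n (tensObj M) (tmk M m (a 0)) (contract i (Fin.tail a))) =
        - ∑ i ∈ Finset.range n, (-1 : R) ^ (i + 1 + 1) • pureTensor (n + 1) M m
          (contract (i + 1) a) := by
      rw [← Finset.sum_neg_distrib]
      refine Finset.sum_congr rfl fun i _ => ?_
      rw [map_smul, contract_succ, pureTensor_cons, pow_succ _ (i + 1), mul_neg_one, neg_smul, neg_neg]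
    rw [h1, h2, h3, pow_succ _ (n + 1), mul_neg_one, neg_smul, zero_add, pow_one, neg_smul, one_smul]
    abel

variable (R B) in
/-- `B` as an `R`-module is the `R`-module underlying the diagonal bimodule. -/
def diagEquiv : B ≃ₗ[R] diag R B where
  toFun x := x
  invFun x := x
  left_inv _ := rfl
  right_inv _ := rfl
  map_add' _ _ := rfl
  map_smul' r x := by
    let _ : Module (Env R B) B := TensorProduct.Algebra.module
    change r • x = (algebraMap R (Env R B) r) • x
    rw [Algebra.TensorProduct.algebraMap_apply, TensorProduct.Algebra.smul_def]
    simp [Algebra.smul_def]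

lemma smul_diagEquiv (b : B) (c : Bᵐᵒᵖ) (x : B) :
    (b ⊗ₜ[R] c : Env R B) • diagEquiv R B x = diagEquiv R B (b * (x * c.unop)) := by
  let _ : Module (Env R B) B := TensorProduct.Algebra.module
  change (b ⊗ₜ[R] c : Env R B) • x = b * (x * c.unop)
  rw [TensorProduct.Algebra.smul_def]
  rfl

variable (R B) in
/-- The isomorphism of the module of Hochschild chains with `B ⊗ B^{⊗n}`. -/
def chainEquiv (n : ℕ) : TensorPow R B n ≃ₗ[R] tensPow n (diag R B) :=
  ((tensorCons R B n).symm.trans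
    (TensorProduct.congr (diagEquiv R B) (LinearEquiv.refl R _))).trans (tensPowEquiv n (diag R B))

lemma chainEquiv_tp (n : ℕ) (a : Fin (n + 1) → B) :
    chainEquiv R B n (tp R B n a) =
      pureTensor n (diag R B) (diagEquiv R B (a 0)) (Fin.tail a) := by
  have h : (tensorCons R B n).symm (tp R B n a) =
      a 0 ⊗ₜ PiTensorProduct.tprod R (Fin.tail a) := by
    refine (LinearEquiv.symm_apply_eq _).2 ?_
    rw [tensorCons_tmul, Fin.cons_self_tail]
    rfl
  change tensPowEquiv n (diag R B) (TensorProduct.congr (diagEquiv R B) (LinearEquiv.refl R _)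
    ((tensorCons R B n).symm (tp R B n a))) = _
  rw [h, TensorProduct.congr_tmul, LinearEquiv.refl_apply, tensPowEquiv_tmul]

/-- With the entry `a 0` as coefficient, the zeroth face is the right action of `a 1`, the cyclic
last face is the left action of the last entry, and the intermediate faces are contractions. -/
lemma coeffDiff_chainEquiv (n : ℕ) :
    coeffDiff n (diag R B) ∘ₗ (chainEquiv R B (n + 1)).toLinearMap =
      (chainEquiv R B n).toLinearMap ∘ₗ hochDiff R B n := by
  refine tensorPow_ext R B fun a => ?_
  have h0 : faceMap R B n 0 (tp R B _ a) = tp R B n (Fin.cons (a 0 * a 1) (Fin.tail (Fin.tail a))) := by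
    rw [faceMap_tp R B (Nat.zero_le n)]
    exact congrArg (tp R B n) (contract_zero a)
  have hs : ∀ i ∈ Finset.range n, (-1 : R) ^ (i + 1) • faceMap R B n (i + 1) (tp R B _ a) =
      (-1 : R) ^ (i + 1) • tp R B n (Fin.cons (a 0) (contract i (Fin.tail a))) := fun i hi => by
    rw [faceMap_tp R B (show i + 1 ≤ n from Finset.mem_range.1 hi)]
    exact congrArg (fun t => (-1 : R) ^ (i + 1) • tp R B n t) (contract_succ i a)
  have hl : faceMap R B n (n + 1) (tp R B _ a) =
      tp R B n (Fin.cons (a (Fin.last (n + 1)) * a 0) (Fin.init (Fin.tail a))) := by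
    rw [faceMap_last, LinearMap.comp_apply, cyclicPerm_tp, faceMap_tp R B (Nat.zero_le n)]
    refine congrArg (tp R B n) ((contract_zero _).trans ?_)
    congr 1
  simp only [LinearMap.comp_apply, LinearEquiv.coe_coe]
  rw [chainEquiv_tp, coeffDiff_pureTensor, hochDiff, LinearMap.sum_apply, Finset.sum_range_succ,
    Finset.sum_range_succ']
  simp only [LinearMap.smul_apply]
  rw [h0, hl, Finset.sum_congr rfl hs]
  simp only [map_add, map_sum, map_smul, chainEquiv_tp, Fin.cons_zero, Fin.tail_cons,
    smul_diagEquiv, pow_zero, one_smul, MulOpposite.unop_op, MulOpposite.unop_one, one_mul, mul_one]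
  rw [add_comm (∑ i ∈ Finset.range n, _)]
  rfl

lemma hochschildComplex_exactAt [Module.Flat R B] (k : ℕ) [HasProjectiveDimensionLT (diag R B) k]
    (n : ℕ) (hn : k ≤ n) : (hochschildComplex R B).ExactAt n := by
  have hk : ∀ (n : ℕ), k ≤ n + 1 → (hochschildComplex R B).ExactAt (n + 1 : ℕ) := by
    intro n hn
    have : HasProjectiveDimensionLT (diag R B) (n + 1) := hasProjectiveDimensionLT_of_ge _ k _ hn
    rw [exactAt_down_iff _ (i := (n + 2 : ℕ)) (k := (n : ℕ)) (by push_cast; ring) (by push_cast; ring)]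
    intro (x : TensorPow R B (n + 1)) hx
    have hx' : hochDiff R B n x = 0 :=
      (congrArg (fun t => t.hom x) (hochD_succ R B n)).symm.trans hx
    obtain ⟨y, hy⟩ := acyclic_of_hasProjectiveDimensionLT n n le_rfl (diag R B)
      (chainEquiv R B (n + 1) x) (by
        rw [← LinearEquiv.coe_coe, ← LinearMap.comp_apply, coeffDiff_chainEquiv,
          LinearMap.comp_apply, hx', map_zero])
    obtain ⟨y, rfl⟩ := (chainEquiv R B (n + 2)).surjective y
    refine ⟨y, (congrArg (fun t => t.hom y) (hochD_succ R B (n + 1))).trans ?_⟩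
    apply (chainEquiv R B (n + 1)).injective
    rw [← hy]
    exact (LinearMap.congr_fun (coeffDiff_chainEquiv (n + 1)) y).symm
  rcases n with _ | n
  -- Degree zero is claimed only when `k = 0`, that is, when `B = 0`; then the chains themselves
  -- vanish.
  · obtain rfl : k = 0 := by omega
    have hz : Subsingleton (diag R B) := ModuleCat.subsingleton_of_isZero
      (isZero_of_hasProjectiveDimensionLT_zero (diag R B))
    have hT : Subsingleton (TensorPow R B 0) := by
      have : (LinearMap.id : TensorPow R B 0 →ₗ[R] TensorPow R B 0) = 0 := by
        refine tensorPow_ext R B fun a => ?_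
        have : a = 0 := funext fun i => (diagEquiv R B).injective (Subsingleton.elim _ _)
        rw [this, LinearMap.id_apply]
        exact (tp R B 0).map_coord_zero 0 rfl
      exact ⟨fun x y => by
        rw [← LinearMap.id_apply (R := R) x, ← LinearMap.id_apply (R := R) y, this]; rfl⟩
    exact ShortComplex.exact_of_isZero_X₂ _ (ModuleCat.isZero_of_subsingleton
      (ModuleCat.of R (TensorPow R B 0)))
  · exact hk n hn

lemma hochschildComplex_exactAt_of_calabiYau [HasDerivedCategory.{w} (ModuleCat.{v} (Env R B))]
    {d : ℤ} (h : CalabiYau R B d) (i : ℤ) (hi : d < i) : (hochschildComplex R B).ExactAt i := by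
  have := h.smooth.flat
  have := hasProjectiveDimensionLT_diag h
  rcases i with n | n
  · exact hochschildComplex_exactAt (d + 1).toNat n (by
      have : d < (n : ℤ) := hi
      omega)
  -- In negative degrees there are no chains.
  · exact ShortComplex.exact_of_isZero_X₂ _ (ModuleCat.isZero_of_subsingleton
      (ModuleCat.of R PUnit))
end comparison

end CY

end

theorem proposition5p7 {R : Type u} {B : Type v} [CommRing R] [Ring B] [Algebra R B]
    [HasDerivedCategory.{w} (ModuleCat.{v} (CY.Env R B))] (d : ℤ) (h : CY.CalabiYau R B d) :
    (∀ i : ℤ, d < i → IsZero (CY.HCneg R B i)) ∧ IsIso (CY.HCnegToHH R B d) := by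
  have hE := CY.hochschildComplex_exactAt_of_calabiYau h
  exact ⟨fun i hi => (CY.MixedComplex.exactAt_negCyclic _ fun j hj =>
    hE j (by omega)).isZero_homology, CY.MixedComplex.isIso_homologyMap_negProj _ hE⟩
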